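/- Write $z=x+iy$, $r=|z|$, $\partial_z=\tfrac12(\partial_x-i\partial_y)$, $\partial_{\bar z}=\tfrac12(\partial_x+i\partial_y)$, and let $C\in\mathbb R$. Put $$\gamma=i(x^2-y^2),\qquad \delta=-y\Big(\frac{y^2}{3}-x^2-1\Big)-i\Big[x\Big(1+y^2-\frac{x^2}{3}\Big)+t-C\Big],$$ $$\widetilde U=-i\,\frac{|z|^2\bar\gamma+\gamma+\delta z-\bar\delta\bar z}{|\gamma|^2+|\delta|^2},\qquad a=\frac{z(\bar\gamma-\gamma)-\delta z^2-\bar\delta}{|\gamma|^2+|\delta|^2},\qquad \widetilde V=a^2+\frac{2\widetilde U}{1+|z|^2}+\frac{2i\bar z a}{1+|z|^2}.$$ These functions arise as follows. (0a) For every $t$ the surface $$F_t=(u^1,u^2,u^3)=\Big(y\big(\tfrac{y^2}{3}-x^2-1\big),\ x\big(1+y^2-\tfrac{x^2}{3}\big)+t-C,\ x^2-y^2\Big)$$ is the Enneper surface, given by the Weierstrass representation $\partial_z u^1=\tfrac i2(\psi_1^2+\bar\psi_2^2)$, $\partial_z u^2=\tfrac12(\bar\psi_2^2-\psi_1^2)$,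 $\partial_z u^3=\psi_1\bar\psi_2$ with $\psi_1=z$, $\psi_2=1$, translated along the $u^2$-axis, the image of $x=y=0$ at $t=0$ being $(0,-C,0)$; and $$\widetilde S:=\begin{pmatrix}\gamma&\delta\\-\bar\delta&\bar\gamma\end{pmatrix}=\begin{pmatrix}iu^3&-u^1-iu^2\\u^1-iu^2&-iu^3\end{pmatrix}.$$ (0b) $(\widetilde U,\widetilde V)$ is, away from $(x,y,t)=(0,0,C)$, the Moutard transform of the zero solution defined by $\Psi=\begin{pmatrix}z&-1\\1&\bar z\end{pmatrix}$ and $\widetilde S$. That is: the rows of $\Psi$ satisfy $\partial_{\bar z}\Psi_{1j}=0$, $\partial_z\Psi_{2j}=0$, and $\Psi_t=(\partial_z^3+\partial_{\bar z}^3)\Psi$; with $\Gamma=\begin{pmatrix}0&1\\-1&0\end{pmatrix}$ and $\sigma_3=\mathrm{diag}(1,-1)$ one has $$d\widetilde S=\Gamma\big(\Psi^\top\Psi\,dy-i\Psi^\top\sigma_3\Psi\,dx+i(\Psi_{yy}^\top\sigma_3\Psi+\Psi^\top\sigma_3\Psi_{yy}-\Psi_y^\top\sigma_3\Psi_y)\,dt\big);$$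 and, for $(x,y,t)\neq(0,0,C)$, $\widetilde S$ and $\Psi$ are invertible, $$\Psi\widetilde S^{-1}\Gamma\Psi^\top\Gamma^{-1}=\begin{pmatrix}iW&\alpha\\-\bar\alpha&-iW\end{pmatrix},\qquad \Gamma\Psi_y\Psi^{-1}\Gamma^{-1}=\begin{pmatrix}b&c\\-\bar c&\bar b\end{pmatrix}$$ with $W$ real, and $\widetilde U=W$, $\widetilde V=\alpha^2+2(\alpha\bar b-i\bar c W)$. (0c) For $(x,y,t)\neq(0,0,C)$, $$\widetilde U=-\frac{3\big((x^2+y^2+3)(x^2-y^2)-6x(C-t)\big)}{Q},$$ $$Q=(x^2+y^2)^3+3(x^4+y^4)+18x^2y^2+9(x^2+y^2)+9(C-t)^2+(6x^3-18xy^2-18x)(C-t)\neq0.$$ Moreover: 1. On $\mathbb R^3\setminus\{(0,0,C)\}$ the functions $\widetilde U$ (real-valued) and $\widetilde V$ are smooth and satisfy the modified Novikov–Veselov equation $$U_t=\big(U_{zzz}+3U_zV+\tfrac32UV_z\big)+\big(U_{\bar z\bar z\bar z}+3U_{\bar z}\bar V+\tfrac32U\bar V_{\bar z}\big),\qquad V_{\bar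 z}=(U^2)_z.$$ 2. For every fixed $t$, $\widetilde U=O(r^{-2})$ and $\widetilde V=O(r^{-2})$ as $r\to\infty$. 3. $\widetilde U$ and $\widetilde V$ are real-analytic in $(x,y,t)$ for $t\ne C$. 4. Their only singularity is at $x=y=0$, $t=C$: the denominator $|\gamma|^2+|\delta|^2$ vanishes exactly there, both functions are real-analytic at every other point of $\mathbb R^3$, and neither has a finite limit at that point. For every $\varphi\in\mathbb R$, $$\lim_{r\to0+}\widetilde U(re^{i\varphi},C)=-\cos2\varphi .$$ 5. For every $t$, $\widetilde U(\cdot,t)$ is square-integrable and $\displaystyle\int_{\mathbb R^2}|\widetilde U|^2\,dx\,dy=3\pi$ if $t\neq C$, and $=2\pi$ if $t=C$. -/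

import Mathlib

open scoped ContDiff Topology ComplexConjugate

noncomputable section

namespace MNV

/-! ### Wirtinger calculus. Points of the plane are `z = x + i y : ℂ`, time is `t : ℝ`. -/

/-- `∂f/∂x`. -/
def dx (f : ℂ → ℂ) (z : ℂ) : ℂ := fderiv ℝ f z 1

/-- `∂f/∂y`. -/
def dy (f : ℂ → ℂ) (z : ℂ) : ℂ := fderiv ℝ f z Complex.I

/-- `∂f/∂z = (∂f/∂x - i ∂f/∂y) / 2`. -/
def dz (f : ℂ → ℂ) (z : ℂ) : ℂ := (dx f z - Complex.I * dy f z) / 2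

/-- `∂f/∂z̄ = (∂f/∂x + i ∂f/∂y) / 2`. -/
def dzbar (f : ℂ → ℂ) (z : ℂ) : ℂ := (dx f z + Complex.I * dy f z) / 2

/-! ### The modified Novikov–Veselov equation -/

/-- `(U, V)` is a smooth solution, with `U` real-valued, of the modified Novikov–Veselov equation
`U_t = (U_zzz + 3 U_z V + (3/2) U V_z) + (U_z̄z̄z̄ + 3 U_z̄ V̄ + (3/2) U V̄_z̄)`, `V_z̄ = (U²)_z`
on the open set `Ω` of space-time. -/
structure IsMNVSolutionOn (Ω : Set (ℂ × ℝ)) (U V : ℂ → ℝ → ℂ) : Prop where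
  isOpen : IsOpen Ω
  smooth_U : ContDiffOn ℝ ∞ (fun p : ℂ × ℝ => U p.1 p.2) Ω
  smooth_V : ContDiffOn ℝ ∞ (fun p : ℂ × ℝ => V p.1 p.2) Ω
  real_U : ∀ z t, (z, t) ∈ Ω → (U z t).im = 0
  constraint : ∀ z t, (z, t) ∈ Ω →
    dzbar (fun w => V w t) z = dz (fun w => U w t ^ 2) z
  evolution : ∀ z t, (z, t) ∈ Ω →
    deriv (fun s => U z s) t =
      (dz (dz (dz fun w => U w t)) z
        + 3 * dz (fun w => U w t) z * V z t
        + 3 / 2 * U z t * dz (fun w => V w t) z)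
      + (dzbar (dzbar (dzbar fun w => U w t)) z
        + 3 * dzbar (fun w => U w t) z * conj (V z t)
        + 3 / 2 * U z t * dzbar (fun w => conj (V w t)) z)

/-! ### The Weierstrass representation -/

/-- `F = (u¹, u², u³)` is a minimal surface with Weierstrass data `ψ₁, ψ₂` (`ψ₁` and `ψ̄₂` being
holomorphic), i.e. `du¹ = (i/2) ((ψ₁² + ψ̄₂²) dz - (ψ̄₁² + ψ₂²) dz̄)`,
`du² = (1/2) ((ψ̄₂² - ψ₁²) dz + (ψ₂² - ψ̄₁²) dz̄)`, `du³ = ψ₁ ψ̄₂ dz + ψ̄₁ ψ₂ dz̄`. -/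
structure IsWeierstrassSurface (ψ₁ ψ₂ : ℂ → ℂ) (F : ℂ → Fin 3 → ℝ) : Prop where
  holomorphic₁ : Differentiable ℂ ψ₁
  holomorphic₂ : Differentiable ℂ (fun z => conj (ψ₂ z))
  differentiable : Differentiable ℝ F
  dz_u1 : ∀ z, dz (fun w => (F w 0 : ℂ)) z = Complex.I / 2 * (ψ₁ z ^ 2 + conj (ψ₂ z) ^ 2)
  dzbar_u1 : ∀ z, dzbar (fun w => (F w 0 : ℂ)) z =
    -(Complex.I / 2) * (conj (ψ₁ z) ^ 2 + ψ₂ z ^ 2)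
  dz_u2 : ∀ z, dz (fun w => (F w 1 : ℂ)) z = 1 / 2 * (conj (ψ₂ z) ^ 2 - ψ₁ z ^ 2)
  dzbar_u2 : ∀ z, dzbar (fun w => (F w 1 : ℂ)) z = 1 / 2 * (ψ₂ z ^ 2 - conj (ψ₁ z) ^ 2)
  dz_u3 : ∀ z, dz (fun w => (F w 2 : ℂ)) z = ψ₁ z * conj (ψ₂ z)
  dzbar_u3 : ∀ z, dzbar (fun w => (F w 2 : ℂ)) z = conj (ψ₁ z) * ψ₂ z

/-- The identification `ℝ³ ≅ su(2)`. -/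
def su2 (u : Fin 3 → ℝ) : Matrix (Fin 2) (Fin 2) ℂ :=
  !![Complex.I * u 2, -(u 0 : ℂ) - Complex.I * u 1;
     (u 0 : ℂ) - Complex.I * u 1, -(Complex.I * u 2)]

/-! ### The Moutard transformation of the zero potential -/

/-- Time-dependent `2 × 2` matrix functions on the plane. -/
abbrev MatFun := ℂ → ℝ → Matrix (Fin 2) (Fin 2) ℂ

def Gam : Matrix (Fin 2) (Fin 2) ℂ := !![0, 1; -1, 0]

def sigma3 : Matrix (Fin 2) (Fin 2) ℂ := !![1, 0; 0, -1]

/-- Entrywise `∂/∂y` of a matrix function. -/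
def matDy (Ψ : MatFun) : MatFun :=
  fun z t => Matrix.of fun i j => dy (fun w => Ψ w t i j) z

/-- `Ψ = (ψ, ψ*)`, the matrix with columns `ψ = (ψ₁, ψ₂)` and `ψ* = (-ψ̄₂, ψ̄₁)`. -/
def spinorMatrix (ψ₁ ψ₂ : ℂ → ℝ → ℂ) : MatFun :=
  fun z t => !![ψ₁ z t, -conj (ψ₂ z t); ψ₂ z t, conj (ψ₁ z t)]

/-- The coefficients of `dx`, `dy`, `dt` of the matrix 1-form `ω̃(Ψ, Ψ)` for `U = V = 0`:
`ω̃ = Ψᵀ Ψ dy - i Ψᵀ σ₃ Ψ dx + i (Ψᵀ_yy σ₃ Ψ + Ψᵀ σ₃ Ψ_yy - Ψᵀ_y σ₃ Ψ_y) dt`. -/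
def omegaX (Ψ : MatFun) : MatFun :=
  fun z t => -Complex.I • ((Ψ z t).transpose * sigma3 * Ψ z t)

def omegaY (Ψ : MatFun) : MatFun :=
  fun z t => (Ψ z t).transpose * Ψ z t

def omegaT (Ψ : MatFun) : MatFun :=
  fun z t => Complex.I •
    ((matDy (matDy Ψ) z t).transpose * sigma3 * Ψ z t
      + (Ψ z t).transpose * sigma3 * matDy (matDy Ψ) z t
      - (matDy Ψ z t).transpose * sigma3 * matDy Ψ z t)

/-- `dS = Γ ω̃(Ψ, Ψ)` on all of space-time. -/
structure IsMoutardPrimitive (Ψ S : MatFun) : Prop where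
  deriv_x : ∀ z t i j,
    HasDerivAt (fun s : ℝ => S (z + s) t i j) ((Gam * omegaX Ψ z t) i j) 0
  deriv_y : ∀ z t i j,
    HasDerivAt (fun s : ℝ => S (z + s * Complex.I) t i j) ((Gam * omegaY Ψ z t) i j) 0
  deriv_t : ∀ z t i j,
    HasDerivAt (fun s : ℝ => S z s i j) ((Gam * omegaT Ψ z t) i j) t

/-- `K = Ψ S⁻¹ Γ Ψᵀ Γ⁻¹`. -/
def moutardK (Ψ S : MatFun) : MatFun :=
  fun z t => Ψ z t * (S z t)⁻¹ * Gam * (Ψ z t).transpose * Gam⁻¹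

/-- `M = Γ Ψ_y Ψ⁻¹ Γ⁻¹`. -/
def moutardM (Ψ : MatFun) : MatFun :=
  fun z t => Gam * matDy Ψ z t * (Ψ z t)⁻¹ * Gam⁻¹

/-- `(U, V)` is, on `Ω`, the Moutard transform of the zero solution `(0, 0)` defined by `Ψ` and by
the choice `S` of a primitive of `Γ ω̃(Ψ, Ψ)`. Here `Ψ` solves the linear problem
`𝒟₀ Ψ = 0`, `Ψ_t = (∂³ + ∂̄³) Ψ` with zero potential, and, in terms of
`K = (iW, a; -ā, -iW)` and `M = (b, c; -c̄, b̄)` with `W` real, `U = W` and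
`V = a² + 2 (a b̄ - i c̄ W)`. -/
structure IsMoutardTransformOfZero (Ω : Set (ℂ × ℝ)) (Ψ S : MatFun) (U V : ℂ → ℝ → ℂ) :
    Prop where
  smooth : ∀ i j, ContDiff ℝ ∞ (fun p : ℂ × ℝ => Ψ p.1 p.2 i j)
  dirac₀ : ∀ z t j, dz (fun w => Ψ w t 1 j) z = 0
  dirac₁ : ∀ z t j, dzbar (fun w => Ψ w t 0 j) z = 0
  evolution : ∀ z t i j, deriv (fun s => Ψ z s i j) t =
    dz (dz (dz fun w => Ψ w t i j)) z + dzbar (dzbar (dzbar fun w => Ψ w t i j)) z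
  primitive : IsMoutardPrimitive Ψ S
  isUnit_S : ∀ z t, (z, t) ∈ Ω → IsUnit (S z t)
  isUnit_Ψ : ∀ z t, (z, t) ∈ Ω → IsUnit (Ψ z t)
  transform : ∀ z t, (z, t) ∈ Ω → ∃ (W : ℝ) (a b c : ℂ),
    moutardK Ψ S z t = !![Complex.I * W, a; -conj a, -(Complex.I * W)] ∧
    moutardM Ψ z t = !![b, c; -conj c, conj b] ∧
    U z t = W ∧
    V z t = a ^ 2 + 2 * (a * conj b - Complex.I * conj c * W)

/-! ### The Enneper surface and the explicit solution -/

/-- The Enneper surface translated so that at time `t` the image of `x = y = 0` is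
`(0, t - C, 0)`. -/
def enneper (C t : ℝ) (z : ℂ) : Fin 3 → ℝ :=
  ![z.im * (z.im ^ 2 / 3 - z.re ^ 2 - 1),
    z.re * (1 + z.im ^ 2 - z.re ^ 2 / 3) + (t - C),
    z.re ^ 2 - z.im ^ 2]

def gam (z : ℂ) : ℂ := Complex.I * ((z.re ^ 2 - z.im ^ 2 : ℝ) : ℂ)

def del (C : ℝ) (z : ℂ) (t : ℝ) : ℂ :=
  ((-(z.im * (z.im ^ 2 / 3 - z.re ^ 2 - 1)) : ℝ) : ℂ)
    - Complex.I * ((z.re * (1 + z.im ^ 2 - z.re ^ 2 / 3) + (t - C) : ℝ) : ℂ)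

/-- The matrix `S̃ = (γ, δ; -δ̄, γ̄)`. -/
def enneperS (C : ℝ) : MatFun :=
  fun z t => !![gam z, del C z t; -conj (del C z t), conj (gam z)]

/-- `|γ|² + |δ|²`. -/
def den (C : ℝ) (z : ℂ) (t : ℝ) : ℝ := ‖gam z‖ ^ 2 + ‖del C z t‖ ^ 2

/-- `Ũ = -i (|z|² γ̄ + γ + δ z - δ̄ z̄) / (|γ|² + |δ|²)`. -/
def Utilde (C : ℝ) (z : ℂ) (t : ℝ) : ℂ :=
  -Complex.I * ((‖z‖ ^ 2 : ℝ) * conj (gam z) + gam z + del C z t * z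
    - conj (del C z t) * conj z) / (den C z t : ℂ)

/-- `a = (z (γ̄ - γ) - δ z² - δ̄) / (|γ|² + |δ|²)`. -/
def aCoef (C : ℝ) (z : ℂ) (t : ℝ) : ℂ :=
  (z * (conj (gam z) - gam z) - del C z t * z ^ 2 - conj (del C z t)) / (den C z t : ℂ)

/-- `Ṽ = a² + 2 Ũ / (1 + |z|²) + 2 i z̄ a / (1 + |z|²)`. -/
def Vtilde (C : ℝ) (z : ℂ) (t : ℝ) : ℂ :=
  aCoef C z t ^ 2 + 2 * Utilde C z t / ((1 + ‖z‖ ^ 2 : ℝ) : ℂ)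
    + 2 * Complex.I * conj z * aCoef C z t / ((1 + ‖z‖ ^ 2 : ℝ) : ℂ)

/-- The polynomial denominator of the rational formula for `Ũ`. -/
def Qpoly (C x y t : ℝ) : ℝ :=
  (x ^ 2 + y ^ 2) ^ 3 + 3 * (x ^ 4 + y ^ 4) + 18 * x ^ 2 * y ^ 2 + 9 * (x ^ 2 + y ^ 2)
    + 9 * (C - t) ^ 2 + (6 * x ^ 3 - 18 * x * y ^ 2 - 18 * x) * (C - t)

/-- The rational formula for `Ũ`. -/
def Urat (C x y t : ℝ) : ℝ :=
  -(3 * ((x ^ 2 + y ^ 2 + 3) * (x ^ 2 - y ^ 2) - 6 * x * (C - t))) / Qpoly C x y t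

end MNV

end

open MNV Filter Asymptotics MeasureTheory

noncomputable section

namespace MNV

/-! ### The tau function in the variables `z`, `w = z̄`, `s = t - C` -/

/-! Everything is governed by one polynomial, τ = |γ|² + |δ|² = det S̃ = |F_t|², the squared
distance from the origin to the point F_t(z) of the translated Enneper surface. Write w for z̄ and s
for t - C, and treat z, w, s as independent. Then `Utilde_eq` and `aCoef_eq` give Ũ = N/τ and a = -i
τ_z/τ with N a quartic polynomial. By `Vtilde_eq` the factors 1 + |z|² in Ṽ cancel, which leaves Ṽ =
∂_z² log τ, while `num_sq` says Ũ² = ∂_z ∂_z̄ log τ.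

Regularity: τ vanishes only when the surface point is the origin, hence only at z = 0, t = C
(`den_eq_zero_iff`). Elsewhere Ũ and Ṽ are quotients of polynomials with non-zero denominator, so
they are real-analytic.

The equation: the constraint V_z̄ = (U²)_z expresses the symmetry of the third derivatives of log τ,
and comes down to `num_sq` and its z-derivative `num_mul_numZ`. For the evolution, the terms with τ⁴
in the denominator cancel in U_zzz + 3 U_z V + (3/2) U V_z (`thirdDeriv_add`). The antiholomorphic
half is the complex conjugate because Ũ is real. After multiplication by τ³ a polynomial identity in
z, w, s remains, `hirota_identity`.

Decay: δ has leading part i z̄³/3, so τ grows like |z|⁶, whereas N has degree 4 and τ_zz τ - τ_z²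
has degree at most 10.

The integral: Ũ² = ∂_z̄(τ_z/τ), so by the divergence theorem (`integral_dzbar_eq`) its integral is π
times the difference of the limits of z τ_z/τ at infinity and at the origin. At infinity τ ~ |z|⁶/9
gives 3. At the origin the limit is 0 if τ(0) ≠ 0, that is t ≠ C, but for t = C one has τ ~ |z|² and
the limit is 1. This accounts for 3π and 2π. -/

def quad (z w : ℂ) : ℂ := (z ^ 2 + w ^ 2) / 2

/-- At w = z̄ and s = t - C this is -u² - i u¹, and `quad` is u³. The second variable stands for z̄,
so that conjugation exchanges z and w and identities can be checked as polynomial identities. -/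
def cubic (z w s : ℂ) : ℂ := z ^ 3 / 3 - w - s

/-- `τ = |γ|² + |δ|²`, a polynomial symmetric in `z` and `w`; `Ũ² = ∂_z ∂_z̄ log τ` and
`Ṽ = ∂_z² log τ`. -/
def tau (z w s : ℂ) : ℂ := quad z w ^ 2 + cubic z w s * cubic w z s

/-- `∂_z τ`; by symmetry `∂_w τ` is `tauZ w z s`. -/
def tauZ (z w s : ℂ) : ℂ := 2 * quad z w * z + z ^ 2 * cubic w z s - cubic z w s

def tauZZ (z w s : ℂ) : ℂ := 2 * quad z w + 2 * z * cubic w z s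

/-- The numerator of `Ũ`. -/
def num (z w s : ℂ) : ℂ := -(z * w * (z ^ 2 + w ^ 2) / 6 + (z ^ 2 + w ^ 2) / 2 + s * (z + w))

/-- This is ∂_z of `num`; by the symmetry of `num`, ∂_w is `numZ w z s`. -/
def numZ (z w s : ℂ) : ℂ := -(z ^ 2 * w / 2 + w ^ 3 / 6 + z + s)

lemma tau_symm (z w s : ℂ) : tau w z s = tau z w s := by
  simp only [tau, quad, cubic]; ring

lemma num_symm (z w s : ℂ) : num w z s = num z w s := by
  simp only [num]; ring

/-! ### Expressing γ, δ, Ũ, a and Ṽ through τ -/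

lemma gam_eq (z : ℂ) : gam z = Complex.I * quad z (conj z) := by
  apply Complex.ext <;> simp [gam, quad, pow_two]
  ring

lemma del_eq (C : ℝ) (z : ℂ) (t : ℝ) :
    del C z t = Complex.I * cubic (conj z) z ((t - C : ℝ) : ℂ) := by
  apply Complex.ext <;> simp [del, cubic, pow_succ] <;> ring

lemma conj_quad (z w : ℂ) : conj (quad z w) = quad (conj z) (conj w) := by
  simp [quad, map_ofNat]

lemma conj_cubic (z w s : ℂ) : conj (cubic z w s) = cubic (conj z) (conj w) (conj s) := by
  simp [cubic, map_ofNat]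

lemma conj_tau (z w s : ℂ) : conj (tau z w s) = tau (conj z) (conj w) (conj s) := by
  simp [tau, conj_quad, conj_cubic]

lemma conj_tauZ (z w s : ℂ) : conj (tauZ z w s) = tauZ (conj z) (conj w) (conj s) := by
  simp [tauZ, conj_quad, conj_cubic, map_ofNat]

lemma conj_tauZZ (z w s : ℂ) : conj (tauZZ z w s) = tauZZ (conj z) (conj w) (conj s) := by
  simp [tauZZ, conj_quad, conj_cubic, map_ofNat]

lemma conj_num (z w s : ℂ) : conj (num z w s) = num (conj z) (conj w) (conj s) := by
  simp [num, map_ofNat]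

lemma conj_numZ (z w s : ℂ) : conj (numZ z w s) = numZ (conj z) (conj w) (conj s) := by
  simp [numZ, map_ofNat]

lemma conj_gam (z : ℂ) : conj (gam z) = -gam z := by
  simp [gam]

lemma conj_del (C : ℝ) (z : ℂ) (t : ℝ) :
    conj (del C z t) = -(Complex.I * cubic z (conj z) ((t - C : ℝ) : ℂ)) := by
  rw [del_eq, map_mul, conj_cubic, Complex.conj_I, Complex.conj_conj, Complex.conj_ofReal]
  ring

lemma den_eq (C : ℝ) (z : ℂ) (t : ℝ) :
    (den C z t : ℂ) = tau z (conj z) ((t - C : ℝ) : ℂ) := by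
  have h1 := Complex.mul_conj' (gam z)
  have h2 := Complex.mul_conj' (del C z t)
  simp only [den, Complex.ofReal_add, Complex.ofReal_pow, ← h1, ← h2, conj_gam, conj_del]
  rw [gam_eq, del_eq, tau]
  linear_combination (-quad z (conj z) ^ 2
    - cubic (conj z) z ((t - C : ℝ) : ℂ) * cubic z (conj z) ((t - C : ℝ) : ℂ)) * Complex.I_sq

lemma Utilde_eq (C : ℝ) (z : ℂ) (t : ℝ) :
    Utilde C z t = num z (conj z) ((t - C : ℝ) : ℂ) / tau z (conj z) ((t - C : ℝ) : ℂ) := by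
  rw [Utilde, den_eq]
  congr 1
  have h1 := Complex.mul_conj' z
  rw [Complex.ofReal_pow, ← h1, conj_gam, conj_del, gam_eq, del_eq]
  generalize conj z = w
  simp only [num, quad, cubic]
  linear_combination (-(-z * w * ((z ^ 2 + w ^ 2) / 2) + ((z ^ 2 + w ^ 2) / 2)
    + (w ^ 3 / 3 - z - ((t - C : ℝ) : ℂ)) * z
    + (z ^ 3 / 3 - w - ((t - C : ℝ) : ℂ)) * w)) * Complex.I_sq

lemma aCoef_eq (C : ℝ) (z : ℂ) (t : ℝ) :
    aCoef C z t = -Complex.I * tauZ z (conj z) ((t - C : ℝ) : ℂ)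
      / tau z (conj z) ((t - C : ℝ) : ℂ) := by
  rw [aCoef, den_eq]
  congr 1
  rw [conj_gam, conj_del, gam_eq, del_eq, tauZ]
  ring

lemma one_add_mul_conj_ne_zero (z : ℂ) : 1 + z * conj z ≠ 0 := by
  rw [Complex.mul_conj']
  exact_mod_cast (by positivity : (1 + ‖z‖ ^ 2 : ℝ) ≠ 0)

/-- The last two terms of Ṽ add up to 2 (N + z̄ τ_z) / ((1 + |z|²) τ), and N + z̄ τ_z is (1 + |z|²)
τ_zz / 2, so they give τ_zz/τ; the first term a² is -τ_z²/τ². -/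
lemma Vtilde_eq (C : ℝ) (z : ℂ) (t : ℝ) :
    Vtilde C z t = (tauZZ z (conj z) ((t - C : ℝ) : ℂ) * tau z (conj z) ((t - C : ℝ) : ℂ)
      - tauZ z (conj z) ((t - C : ℝ) : ℂ) ^ 2) / tau z (conj z) ((t - C : ℝ) : ℂ) ^ 2 := by
  have h1 : ((1 + ‖z‖ ^ 2 : ℝ) : ℂ) = 1 + z * conj z := by
    rw [Complex.mul_conj']; push_cast; rfl
  have h2 := one_add_mul_conj_ne_zero z
  rw [Vtilde, h1, Utilde_eq, aCoef_eq]
  generalize conj z = w at *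
  generalize ((t - C : ℝ) : ℂ) = s
  -- Division by zero makes both sides 0 at the singular point, so the formula needs no hypothesis
  -- and can be rewritten under binders.
  by_cases hD : tau z w s = 0
  · simp [hD]
  have key : num z w s + w * tauZ z w s = (1 + z * w) * (tauZZ z w s / 2) := by
    simp only [num, tauZ, tauZZ, quad, cubic]; ring
  have hI := Complex.I_sq
  field_simp
  linear_combination (2 * tau z w s) * key + (tauZ z w s ^ 2 * (1 + z * w)
    - 2 * w * tau z w s * tauZ z w s) * hI

/-! ### The zero of the denominator and the rational formula -/

lemma den_eq_zero_iff (C : ℝ) (z : ℂ) (t : ℝ) : den C z t = 0 ↔ (z, t) = ((0 : ℂ), C) := by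
  constructor
  · intro h
    have h1 : ‖gam z‖ ^ 2 = 0 := by
      have := sq_nonneg ‖del C z t‖; have := sq_nonneg ‖gam z‖; unfold den at h; linarith
    have h2 : ‖del C z t‖ ^ 2 = 0 := by
      have := sq_nonneg ‖del C z t‖; have := sq_nonneg ‖gam z‖; unfold den at h; linarith
    have h3 : gam z = 0 := by simpa using h1
    have h4 : del C z t = 0 := by simpa using h2
    have h5 : z.re ^ 2 - z.im ^ 2 = 0 := by
      have := congrArg Complex.im h3
      rw [gam, Complex.I_mul_im, Complex.ofReal_re] at this
      simpa using this
    have h6 : z.im * (z.im ^ 2 / 3 - z.re ^ 2 - 1) = 0 := by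
      have := congrArg Complex.re h4
      rw [del, Complex.sub_re, Complex.I_mul_re, Complex.ofReal_re, Complex.ofReal_im] at this
      simpa using this
    have h7 : z.re * (1 + z.im ^ 2 - z.re ^ 2 / 3) + (t - C) = 0 := by
      have := congrArg Complex.im h4
      rw [del, Complex.sub_im, Complex.I_mul_im, Complex.ofReal_re, Complex.ofReal_im, Complex.zero_im]
        at this
      linarith
    have hy : z.im = 0 := by
      rcases mul_eq_zero.1 h6 with h | h
      · exact h
      -- Since x² = y², the second factor is -(2/3) y² - 1 < 0.
      · nlinarith [sq_nonneg z.im]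
    have hx : z.re = 0 := by
      rw [hy] at h5; simpa using h5
    rw [hx] at h7
    exact Prod.ext (Complex.ext hx hy) (by linarith)
  · intro h
    obtain ⟨rfl, rfl⟩ := Prod.mk.inj h
    simp [den, gam, del]

lemma tau_ne_zero {C : ℝ} {z : ℂ} {t : ℝ} (h : (z, t) ≠ ((0 : ℂ), C)) :
    tau z (conj z) ((t - C : ℝ) : ℂ) ≠ 0 := by
  rw [← den_eq]
  exact_mod_cast mt (den_eq_zero_iff C z t).1 h

lemma nine_mul_den (C : ℝ) (z : ℂ) (t : ℝ) : 9 * den C z t = Qpoly C z.re z.im t := by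
  have h1 : ‖gam z‖ ^ 2 = (z.re ^ 2 - z.im ^ 2) ^ 2 := by
    rw [gam, norm_mul, Complex.norm_I, one_mul, Complex.norm_real, Real.norm_eq_abs, sq_abs]
  have h2 : ‖del C z t‖ ^ 2 = (z.im * (z.im ^ 2 / 3 - z.re ^ 2 - 1)) ^ 2
      + (z.re * (1 + z.im ^ 2 - z.re ^ 2 / 3) + (t - C)) ^ 2 := by
    rw [← Complex.normSq_eq_norm_sq, Complex.normSq_apply, del, Complex.sub_re, Complex.sub_im,
      Complex.I_mul_re, Complex.I_mul_im]
    simp only [Complex.ofReal_re, Complex.ofReal_im]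
    ring
  rw [den, h1, h2, Qpoly]
  ring

lemma Utilde_eq_Urat (C : ℝ) (z : ℂ) (t : ℝ) :
    Utilde C z t = (Urat C z.re z.im t : ℂ) := by
  rw [Utilde_eq, ← den_eq, Urat, ← nine_mul_den]
  have : num z (conj z) ((t - C : ℝ) : ℂ)
      = ((-(((z.re ^ 2 + z.im ^ 2 + 3) * (z.re ^ 2 - z.im ^ 2) - 6 * z.re * (C - t))) / 3 : ℝ)) := by
    apply Complex.ext
    · simp [num, pow_succ]; ring
    · simp [num, pow_succ]; ring
  rw [this]
  rw [← Complex.ofReal_div]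
  congr 1
  by_cases hd : den C z t = 0
  · simp [hd]
  field_simp
  ring

lemma Qpoly_ne_zero {C : ℝ} {z : ℂ} {t : ℝ} (h : (z, t) ≠ ((0 : ℂ), C)) :
    Qpoly C z.re z.im t ≠ 0 := by
  rw [← nine_mul_den]
  exact mul_ne_zero (by norm_num) (mt (den_eq_zero_iff C z t).1 h)

/-! ### Wirtinger derivatives -/

/-- `f` is real differentiable at `z` with `∂f/∂z = a` and `∂f/∂z̄ = b`. -/
def HasWirtingerAt (f : ℂ → ℂ) (a b z : ℂ) : Prop :=
  HasFDerivAt f (a • (1 : ℂ →L[ℝ] ℂ) + b • (Complex.conjCLE : ℂ →L[ℝ] ℂ)) z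

namespace HasWirtingerAt

variable {f g : ℂ → ℂ} {a b a' b' z : ℂ}

lemma dx_eq (h : HasWirtingerAt f a b z) : dx f z = a + b := by
  rw [dx, HasFDerivAt.fderiv h]; simp

lemma dy_eq (h : HasWirtingerAt f a b z) : dy f z = Complex.I * (a - b) := by
  rw [dy, HasFDerivAt.fderiv h]; simp; ring

lemma dz_eq (h : HasWirtingerAt f a b z) : dz f z = a := by
  rw [dz, h.dx_eq, h.dy_eq]
  linear_combination (-(a - b) / 2) * Complex.I_sq

lemma dzbar_eq (h : HasWirtingerAt f a b z) : dzbar f z = b := by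
  rw [dzbar, h.dx_eq, h.dy_eq]
  linear_combination ((a - b) / 2) * Complex.I_sq

lemma congr_values (h : HasWirtingerAt f a b z) (ha : a = a') (hb : b = b') :
    HasWirtingerAt f a' b' z := by
  subst ha hb; exact h

protected lemma const (c z : ℂ) : HasWirtingerAt (fun _ => c) 0 0 z := by
  refine (hasFDerivAt_const (𝕜 := ℝ) c z).congr_fderiv ?_
  apply ContinuousLinearMap.ext
  intro x
  simp

protected lemma id (z : ℂ) : HasWirtingerAt (fun w => w) 1 0 z := by
  refine (hasFDerivAt_id (𝕜 := ℝ) z).congr_fderiv ?_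
  apply ContinuousLinearMap.ext
  intro x
  simp

protected lemma conjugate (z : ℂ) : HasWirtingerAt (fun w => conj w) 0 1 z := by
  refine ((Complex.conjCLE : ℂ →L[ℝ] ℂ).hasFDerivAt (x := z)).congr_fderiv ?_
  apply ContinuousLinearMap.ext
  intro x
  simp

lemma add (hf : HasWirtingerAt f a b z) (hg : HasWirtingerAt g a' b' z) :
    HasWirtingerAt (fun w => f w + g w) (a + a') (b + b') z := by
  refine (HasFDerivAt.add hf hg).congr_fderiv ?_
  apply ContinuousLinearMap.ext
  intro x
  simp
  ring

lemma neg (hf : HasWirtingerAt f a b z) : HasWirtingerAt (fun w => -f w) (-a) (-b) z := by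
  refine (HasFDerivAt.neg hf).congr_fderiv ?_
  apply ContinuousLinearMap.ext
  intro x
  simp
  ring

lemma sub (hf : HasWirtingerAt f a b z) (hg : HasWirtingerAt g a' b' z) :
    HasWirtingerAt (fun w => f w - g w) (a - a') (b - b') z := by
  simpa [sub_eq_add_neg] using hf.add hg.neg

lemma mul (hf : HasWirtingerAt f a b z) (hg : HasWirtingerAt g a' b' z) :
    HasWirtingerAt (fun w => f w * g w) (a * g z + f z * a') (b * g z + f z * b') z := by
  refine (HasFDerivAt.mul hf hg).congr_fderiv ?_
  apply ContinuousLinearMap.ext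
  intro x
  simp
  ring

lemma pow (hf : HasWirtingerAt f a b z) (n : ℕ) :
    HasWirtingerAt (fun w => f w ^ n) (n * f z ^ (n - 1) * a) (n * f z ^ (n - 1) * b) z := by
  refine (HasFDerivAt.pow hf n).congr_fderiv ?_
  apply ContinuousLinearMap.ext
  intro x
  simp
  ring

lemma inv (hf : HasWirtingerAt f a b z) (h0 : f z ≠ 0) :
    HasWirtingerAt (fun w => (f w)⁻¹) (-a / f z ^ 2) (-b / f z ^ 2) z := by
  -- Inversion is holomorphic, so its complex derivative restricted to real scalars suffices for the
  -- chain rule.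
  have h1 : HasFDerivAt (fun w : ℂ => w⁻¹) _ (f z) :=
    (hasFDerivAt_inv h0).restrictScalars ℝ
  refine (h1.comp z hf).congr_fderiv ?_
  apply ContinuousLinearMap.ext
  intro x
  simp
  ring

lemma div (hf : HasWirtingerAt f a b z) (hg : HasWirtingerAt g a' b' z) (h0 : g z ≠ 0) :
    HasWirtingerAt (fun w => f w / g w) ((a * g z - f z * a') / g z ^ 2)
      ((b * g z - f z * b') / g z ^ 2) z := by
  have := hf.mul (hg.inv h0)
  simp only [div_eq_mul_inv (f _) (g _)]
  refine this.congr_values ?_ ?_ <;> field_simp <;> ring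

lemma conj_comp (hf : HasWirtingerAt f a b z) :
    HasWirtingerAt (fun w => conj (f w)) (conj b) (conj a) z := by
  refine ((Complex.conjCLE : ℂ →L[ℝ] ℂ).hasFDerivAt.comp z hf).congr_fderiv ?_
  apply ContinuousLinearMap.ext
  intro x
  simp
  ring

lemma differentiableAt (hf : HasWirtingerAt f a b z) : DifferentiableAt ℝ f z :=
  HasFDerivAt.differentiableAt hf

lemma hasDerivAt_horizontal (hf : HasWirtingerAt f a b z) :
    HasDerivAt (fun s : ℝ => f (z + s)) (a + b) 0 := by
  have h1 : HasDerivAt (fun s : ℝ => z + (s : ℂ)) 1 0 :=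
    (Complex.ofRealCLM.hasDerivAt (x := (0 : ℝ))).const_add z
  have h2 : HasFDerivAt f (a • (1 : ℂ →L[ℝ] ℂ) + b • (Complex.conjCLE : ℂ →L[ℝ] ℂ))
      (z + ((0 : ℝ) : ℂ)) := by
    simpa [HasWirtingerAt] using hf
  refine (h2.comp_hasDerivAt (0 : ℝ) h1).congr_deriv ?_
  simp

lemma hasDerivAt_vertical (hf : HasWirtingerAt f a b z) :
    HasDerivAt (fun s : ℝ => f (z + s * Complex.I)) (Complex.I * (a - b)) 0 := by
  have h1 : HasDerivAt (fun s : ℝ => z + (s : ℂ) * Complex.I) (1 * Complex.I) 0 :=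
    ((Complex.ofRealCLM.hasDerivAt (x := (0 : ℝ))).mul_const Complex.I).const_add z
  have h2 : HasFDerivAt f (a • (1 : ℂ →L[ℝ] ℂ) + b • (Complex.conjCLE : ℂ →L[ℝ] ℂ))
      (z + ((0 : ℝ) : ℂ) * Complex.I) := by
    simpa [HasWirtingerAt] using hf
  refine (h2.comp_hasDerivAt (0 : ℝ) h1).congr_deriv ?_
  simp
  ring

end HasWirtingerAt

lemma _root_.Filter.EventuallyEq.dz_eq {f g : ℂ → ℂ} {z : ℂ} (h : f =ᶠ[𝓝 z] g) :
    dz f z = dz g z := by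
  simp only [dz, dx, dy, h.fderiv_eq]

/-- No differentiability is needed: conjugation is a real-linear isomorphism, so `fderiv` commutes
with it even at junk values. This permits rewriting inside iterated derivatives. -/
lemma dzbar_conj_comp {f : ℂ → ℂ} (z : ℂ) :
    dzbar (fun w => conj (f w)) z = conj (dz f z) := by
  have h : fderiv ℝ (fun w => conj (f w)) z = (Complex.conjCLE : ℂ →L[ℝ] ℂ) ∘L fderiv ℝ f z :=
    Complex.conjCLE.comp_fderiv
  simp only [dz, dzbar, dx, dy, h]
  simp [map_ofNat]

/-! ### Derivatives of the tau function -/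

section tau

variable (z s : ℂ)

lemma hasWirtingerAt_quad :
    HasWirtingerAt (fun z => quad z (conj z)) z (conj z) z := by
  unfold quad
  refine ((((HasWirtingerAt.id z).pow 2).add ((HasWirtingerAt.conjugate z).pow 2)).div
    (.const 2 z) two_ne_zero).congr_values ?_ ?_ <;> simp <;> ring

lemma hasWirtingerAt_cubic :
    HasWirtingerAt (fun z => cubic z (conj z) s) (z ^ 2) (-1) z := by
  unfold cubic
  refine (((((HasWirtingerAt.id z).pow 3).div (.const 3 z) three_ne_zero).sub
    (.conjugate z)).sub (.const s z)).congr_values ?_ ?_ <;> simp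
  ring

lemma hasWirtingerAt_cubic' :
    HasWirtingerAt (fun z => cubic (conj z) z s) (-1) (conj z ^ 2) z := by
  unfold cubic
  refine (((((HasWirtingerAt.conjugate z).pow 3).div (.const 3 z) three_ne_zero).sub
    (.id z)).sub (.const s z)).congr_values ?_ ?_ <;> simp
  ring

lemma hasWirtingerAt_tau :
    HasWirtingerAt (fun z => tau z (conj z) s) (tauZ z (conj z) s) (tauZ (conj z) z s) z := by
  unfold tau
  refine (((hasWirtingerAt_quad z).pow 2).add ((hasWirtingerAt_cubic z s).mul
    (hasWirtingerAt_cubic' z s))).congr_values ?_ ?_ <;> simp [tauZ, quad] <;> ring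

/-- The mixed derivative of τ is the perfect square (1 + z z̄)², the simplification behind `num_sq`.
-/
lemma hasWirtingerAt_tauZ :
    HasWirtingerAt (fun z => tauZ z (conj z) s) (tauZZ z (conj z) s) ((1 + z * conj z) ^ 2) z := by
  unfold tauZ
  refine (((((HasWirtingerAt.const 2 z).mul (hasWirtingerAt_quad z)).mul (.id z)).add
    (((HasWirtingerAt.id z).pow 2).mul (hasWirtingerAt_cubic' z s))).sub
    (hasWirtingerAt_cubic z s)).congr_values ?_ ?_ <;> simp [tauZZ, quad] <;> ring

lemma hasWirtingerAt_tauZZ :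
    HasWirtingerAt (fun z => tauZZ z (conj z) s) (2 * cubic (conj z) z s)
      (2 * conj z * (1 + z * conj z)) z := by
  unfold tauZZ
  refine (((HasWirtingerAt.const 2 z).mul (hasWirtingerAt_quad z)).add
    (((HasWirtingerAt.const 2 z).mul (.id z)).mul (hasWirtingerAt_cubic' z s))).congr_values ?_ ?_
    <;> simp
  ring

lemma hasWirtingerAt_num :
    HasWirtingerAt (fun z => num z (conj z) s) (numZ z (conj z) s) (numZ (conj z) z s) z := by
  unfold num
  refine (((((((HasWirtingerAt.id z).mul (.conjugate z)).mul
    (((HasWirtingerAt.id z).pow 2).add ((HasWirtingerAt.conjugate z).pow 2))).div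
    (.const 6 z) (by norm_num)).add
    ((((HasWirtingerAt.id z).pow 2).add ((HasWirtingerAt.conjugate z).pow 2)).div
    (.const 2 z) two_ne_zero)).add ((HasWirtingerAt.const s z).mul ((HasWirtingerAt.id z).add
    (.conjugate z)))).neg).congr_values ?_ ?_ <;> simp [numZ] <;> ring

lemma hasWirtingerAt_numZ :
    HasWirtingerAt (fun z => numZ z (conj z) s) (-(z * conj z + 1))
      (-((z ^ 2 + conj z ^ 2) / 2)) z := by
  unfold numZ
  refine ((((((((HasWirtingerAt.id z).pow 2).mul (.conjugate z)).div
    (.const 2 z) two_ne_zero).add (((HasWirtingerAt.conjugate z).pow 3).div (.const 6 z)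
    (by norm_num))).add (.id z)).add (.const s z)).neg).congr_values ?_ ?_ <;> simp <;> ring

end tau

/-! ### Analyticity -/

lemma analyticAt_conj_fst (p : ℂ × ℝ) : AnalyticAt ℝ (fun p : ℂ × ℝ => conj p.1) p :=
  ((Complex.conjCLE : ℂ →L[ℝ] ℂ).comp (ContinuousLinearMap.fst ℝ ℂ ℝ)).analyticAt p

lemma analyticAt_time (C : ℝ) (p : ℂ × ℝ) :
    AnalyticAt ℝ (fun p : ℂ × ℝ => ((p.2 - C : ℝ) : ℂ)) p := by
  have h : AnalyticAt ℝ (fun p : ℂ × ℝ => (p.2 : ℂ)) p :=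
    (Complex.ofRealCLM.comp (ContinuousLinearMap.snd ℝ ℂ ℝ)).analyticAt p
  simp only [Complex.ofReal_sub]
  exact h.sub analyticAt_const

lemma analyticAt_tau (C : ℝ) (p : ℂ × ℝ) :
    AnalyticAt ℝ (fun p : ℂ × ℝ => tau p.1 (conj p.1) ((p.2 - C : ℝ) : ℂ)) p := by
  have h1 := analyticAt_conj_fst p
  have h2 := analyticAt_time C p
  have h3 : AnalyticAt ℝ (fun p : ℂ × ℝ => p.1) p := analyticAt_fst
  unfold tau quad cubic
  simp only [div_eq_mul_inv]
  fun_prop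

lemma analyticAt_tauZ (C : ℝ) (p : ℂ × ℝ) :
    AnalyticAt ℝ (fun p : ℂ × ℝ => tauZ p.1 (conj p.1) ((p.2 - C : ℝ) : ℂ)) p := by
  have h1 := analyticAt_conj_fst p
  have h2 := analyticAt_time C p
  have h3 : AnalyticAt ℝ (fun p : ℂ × ℝ => p.1) p := analyticAt_fst
  unfold tauZ quad cubic
  simp only [div_eq_mul_inv]
  fun_prop

lemma analyticAt_tauZZ (C : ℝ) (p : ℂ × ℝ) :
    AnalyticAt ℝ (fun p : ℂ × ℝ => tauZZ p.1 (conj p.1) ((p.2 - C : ℝ) : ℂ)) p := by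
  have h1 := analyticAt_conj_fst p
  have h2 := analyticAt_time C p
  have h3 : AnalyticAt ℝ (fun p : ℂ × ℝ => p.1) p := analyticAt_fst
  unfold tauZZ quad cubic
  simp only [div_eq_mul_inv]
  fun_prop

lemma analyticAt_num (C : ℝ) (p : ℂ × ℝ) :
    AnalyticAt ℝ (fun p : ℂ × ℝ => num p.1 (conj p.1) ((p.2 - C : ℝ) : ℂ)) p := by
  have h1 := analyticAt_conj_fst p
  have h2 := analyticAt_time C p
  have h3 : AnalyticAt ℝ (fun p : ℂ × ℝ => p.1) p := analyticAt_fst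
  unfold num
  simp only [div_eq_mul_inv]
  fun_prop

lemma analyticOnNhd_Utilde (C : ℝ) :
    AnalyticOnNhd ℝ (fun p : ℂ × ℝ => Utilde C p.1 p.2) {((0 : ℂ), C)}ᶜ := by
  intro p hp
  simp only [Utilde_eq]
  exact (analyticAt_num C p).div (analyticAt_tau C p) (tau_ne_zero hp)

lemma analyticOnNhd_Vtilde (C : ℝ) :
    AnalyticOnNhd ℝ (fun p : ℂ × ℝ => Vtilde C p.1 p.2) {((0 : ℂ), C)}ᶜ := by
  intro p hp
  simp only [Vtilde_eq]
  exact (((analyticAt_tauZZ C p).mul (analyticAt_tau C p)).sub ((analyticAt_tauZ C p).pow 2)).div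
    ((analyticAt_tau C p).pow 2) (pow_ne_zero 2 (tau_ne_zero hp))

/-! ### The modified Novikov–Veselov equation -/

lemma eventually_tau_ne_zero {z s : ℂ} (h : tau z (conj z) s ≠ 0) :
    ∀ᶠ w in 𝓝 z, tau w (conj w) s ≠ 0 :=
  (hasWirtingerAt_tau z s).differentiableAt.continuousAt.eventually_ne h

lemma hasWirtingerAt_U {z s : ℂ} (h : tau z (conj z) s ≠ 0) :
    HasWirtingerAt (fun z => num z (conj z) s / tau z (conj z) s)
      ((numZ z (conj z) s * tau z (conj z) s - num z (conj z) s * tauZ z (conj z) s)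
        / tau z (conj z) s ^ 2)
      ((numZ (conj z) z s * tau z (conj z) s - num z (conj z) s * tauZ (conj z) z s)
        / tau z (conj z) s ^ 2) z :=
  (hasWirtingerAt_num z s).div (hasWirtingerAt_tau z s) h

/-- The third derivative of `N / T` in terms of the derivatives `Nᵢ`, `Tᵢ` of `N` and `T`. -/
def thirdDeriv (N N₁ N₂ N₃ T T₁ T₂ T₃ : ℂ) : ℂ :=
  N₃ / T - (3 * N₂ * T₁ + 3 * N₁ * T₂ + N * T₃) / T ^ 2
    + (6 * N₁ * T₁ ^ 2 + 6 * N * T₁ * T₂) / T ^ 3 - 6 * N * T₁ ^ 3 / T ^ 4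

/-- The quotient rule is valid only where τ ≠ 0. This set is open, so each derivative is known in a
neighbourhood and can be differentiated again; the intermediate formulas are put over τ² and τ³. -/
lemma dz_dz_dz_U {z s : ℂ} (h : tau z (conj z) s ≠ 0) :
    dz (dz (dz fun z => num z (conj z) s / tau z (conj z) s)) z =
      thirdDeriv (num z (conj z) s) (numZ z (conj z) s) (-(z * conj z + 1)) (-conj z)
        (tau z (conj z) s) (tauZ z (conj z) s) (tauZZ z (conj z) s) (2 * cubic (conj z) z s) := by
  have e1 : ∀ w, tau w (conj w) s ≠ 0 → dz (fun z => num z (conj z) s / tau z (conj z) s) w =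
      (numZ w (conj w) s * tau w (conj w) s - num w (conj w) s * tauZ w (conj w) s)
        / tau w (conj w) s ^ 2 := fun w hw => (hasWirtingerAt_U hw).dz_eq
  have e2 : ∀ w, tau w (conj w) s ≠ 0 →
      dz (dz (fun z => num z (conj z) s / tau z (conj z) s)) w =
      ((-(w * conj w + 1)) * tau w (conj w) s ^ 2
        - 2 * numZ w (conj w) s * tauZ w (conj w) s * tau w (conj w) s
        - num w (conj w) s * tauZZ w (conj w) s * tau w (conj w) s
        + 2 * num w (conj w) s * tauZ w (conj w) s ^ 2) / tau w (conj w) s ^ 3 := by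
    intro w hw
    rw [EventuallyEq.dz_eq ((eventually_tau_ne_zero hw).mono e1)]
    rw [((((hasWirtingerAt_numZ w s).mul (hasWirtingerAt_tau w s)).sub
      ((hasWirtingerAt_num w s).mul (hasWirtingerAt_tauZ w s))).div
      ((hasWirtingerAt_tau w s).pow 2) (pow_ne_zero 2 hw)).dz_eq]
    field_simp
    push_cast
    ring
  rw [EventuallyEq.dz_eq ((eventually_tau_ne_zero h).mono e2)]
  have hT := hasWirtingerAt_tau z s
  have hT1 := hasWirtingerAt_tauZ z s
  have hT2 := hasWirtingerAt_tauZZ z s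
  have hN := hasWirtingerAt_num z s
  have hN1 := hasWirtingerAt_numZ z s
  have hN2 : HasWirtingerAt (fun z => -(z * conj z + 1)) _ _ z :=
    (((HasWirtingerAt.id z).mul (.conjugate z)).add (.const 1 z)).neg
  have h2 := HasWirtingerAt.const 2 z
  rw [((((hN2.mul (hT.pow 2)).sub (((h2.mul hN1).mul hT1).mul hT)).sub
    ((hN.mul hT2).mul hT)).add ((h2.mul hN).mul (hT1.pow 2)) |>.div (hT.pow 3)
    (pow_ne_zero 3 h)).dz_eq]
  simp only [thirdDeriv]
  field_simp
  push_cast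
  ring

lemma hasWirtingerAt_V {z s : ℂ} (h : tau z (conj z) s ≠ 0) :
    HasWirtingerAt (fun z => (tauZZ z (conj z) s * tau z (conj z) s - tauZ z (conj z) s ^ 2)
        / tau z (conj z) s ^ 2)
      (2 * cubic (conj z) z s / tau z (conj z) s
        - 3 * tauZZ z (conj z) s * tauZ z (conj z) s / tau z (conj z) s ^ 2
        + 2 * tauZ z (conj z) s ^ 3 / tau z (conj z) s ^ 3)
      (2 * conj z * (1 + z * conj z) / tau z (conj z) s
        - (tauZZ z (conj z) s * tauZ (conj z) z s + 2 * tauZ z (conj z) s * (1 + z * conj z) ^ 2)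
          / tau z (conj z) s ^ 2
        + 2 * tauZ z (conj z) s ^ 2 * tauZ (conj z) z s / tau z (conj z) s ^ 3) z := by
  refine ((((hasWirtingerAt_tauZZ z s).mul (hasWirtingerAt_tau z s)).sub
    ((hasWirtingerAt_tauZ z s).pow 2)).div ((hasWirtingerAt_tau z s).pow 2)
    (pow_ne_zero 2 h)).congr_values ?_ ?_
  · field_simp
    push_cast
    ring
  · field_simp
    push_cast
    ring

/-- `N² = τ τ_zw - τ_z τ_w`, i.e. `Ũ² = ∂_z ∂_z̄ log τ`. -/
lemma num_sq (z w s : ℂ) :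
    num z w s ^ 2 = tau z w s * (1 + z * w) ^ 2 - tauZ z w s * tauZ w z s := by
  simp only [num, tau, tauZ, quad, cubic]; ring

/-- This is the z-derivative of `num_sq`: the two terms τ_z τ_zw cancel. -/
lemma num_mul_numZ (z w s : ℂ) :
    2 * num z w s * numZ z w s = 2 * w * (1 + z * w) * tau z w s - tauZZ z w s * tauZ w z s := by
  simp only [num, numZ, tau, tauZ, tauZZ, quad, cubic]; ring

/-- The evolution equation multiplied by τ³. The left side is τ³ U_t; on the right stand the
numerator from `thirdDeriv_add` for the ∂_z half and its image under z ↔ w for the ∂_z̄ half. -/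
lemma hirota_identity (z w s : ℂ) :
    tau z w s ^ 2 * (-(z + w)) + tau z w s * num z w s * (cubic z w s + cubic w z s) =
      tau z w s ^ 2 * (-w) + tau z w s * (3 * (z * w + 1) * tauZ z w s + num z w s * cubic w z s)
        + 3 * tauZ z w s * (numZ z w s * tauZ z w s - num z w s * tauZZ z w s / 2)
      + (tau z w s ^ 2 * (-z) + tau z w s * (3 * (z * w + 1) * tauZ w z s
          + num z w s * cubic z w s)
        + 3 * tauZ w z s * (numZ w z s * tauZ w z s - num z w s * tauZZ w z s / 2)) := by
  simp only [num, numZ, tau, tauZ, tauZZ, quad, cubic]; ring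

/-- With U = N/T and V = (log T)'', the three contributions to N T₁³ / T⁴ are -6, 3 and 3, so the
common denominator drops to T³. -/
lemma thirdDeriv_add (N N₁ N₂ N₃ T T₁ T₂ T₃ : ℂ) (hT : T ≠ 0) :
    thirdDeriv N N₁ N₂ N₃ T T₁ T₂ T₃ + 3 * ((N₁ * T - N * T₁) / T ^ 2) * ((T₂ * T - T₁ ^ 2) / T ^ 2)
      + 3 / 2 * (N / T) * (T₃ / T - 3 * T₂ * T₁ / T ^ 2 + 2 * T₁ ^ 3 / T ^ 3) =
    (T ^ 2 * N₃ + T * (-3 * N₂ * T₁ + N * T₃ / 2) + 3 * T₁ * (N₁ * T₁ - N * T₂ / 2)) / T ^ 3 := by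
  simp only [thirdDeriv]
  field_simp
  ring

lemma hasDerivAt_Utilde_time {C : ℝ} {z : ℂ} {t : ℝ} (h : (z, t) ≠ ((0 : ℂ), C)) :
    HasDerivAt (fun s => Utilde C z s)
      ((-(z + conj z) * tau z (conj z) ((t - C : ℝ) : ℂ) + num z (conj z) ((t - C : ℝ) : ℂ) *
        (cubic z (conj z) ((t - C : ℝ) : ℂ) + cubic (conj z) z ((t - C : ℝ) : ℂ)))
        / tau z (conj z) ((t - C : ℝ) : ℂ) ^ 2) t := by
  have h0 := tau_ne_zero h
  have hs : HasDerivAt (fun s : ℝ => ((s - C : ℝ) : ℂ)) 1 t := by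
    simpa using (((hasDerivAt_id t).sub_const C).ofReal_comp)
  have hc : ∀ z w : ℂ, HasDerivAt (fun s : ℝ => cubic z w ((s - C : ℝ) : ℂ)) (-1) t :=
    fun z w => hs.const_sub _
  have hT := ((hc z (conj z)).mul (hc (conj z) z)).const_add (quad z (conj z) ^ 2)
  have hN := ((hs.mul_const (z + conj z)).const_add
    (z * conj z * (z ^ 2 + conj z ^ 2) / 6 + (z ^ 2 + conj z ^ 2) / 2)).neg
  simp only [Utilde_eq]
  refine (hN.div hT h0).congr_deriv ?_
  congr 1
  simp only [num, tau, Pi.mul_apply, Pi.neg_apply]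
  ring

lemma conj_Utilde (C : ℝ) (z : ℂ) (t : ℝ) : conj (Utilde C z t) = Utilde C z t := by
  rw [Utilde_eq_Urat, Complex.conj_ofReal]

lemma isMNVSolutionOn (C : ℝ) : IsMNVSolutionOn {((0 : ℂ), C)}ᶜ (Utilde C) (Vtilde C) where
  isOpen := isOpen_compl_singleton
  smooth_U := (analyticOnNhd_Utilde C).contDiffOn (isOpen_compl_singleton.uniqueDiffOn)
  smooth_V := (analyticOnNhd_Vtilde C).contDiffOn (isOpen_compl_singleton.uniqueDiffOn)
  real_U z t _ := by rw [Utilde_eq_Urat, Complex.ofReal_im]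
  constraint z t h := by
    have h0 := tau_ne_zero h
    simp only [Utilde_eq, Vtilde_eq]
    rw [(hasWirtingerAt_V h0).dzbar_eq, ((hasWirtingerAt_U h0).pow 2).dz_eq]
    generalize ((t - C : ℝ) : ℂ) = s at *
    have e1 := num_sq z (conj z) s
    have e2 := num_mul_numZ z (conj z) s
    generalize conj z = w at *
    push_cast
    simp only [pow_one]
    field_simp
    -- Now z and w are independent, and clearing denominators leaves a combination of N² and N N_z.
    linear_combination (-tau z w s) * e2 + (2 * tauZ z w s) * e1
  evolution z t h := by
    have h0 := tau_ne_zero h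
    have hV : dzbar (fun w => conj (Vtilde C w t)) z = conj (dz (fun w => Vtilde C w t) z) :=
      dzbar_conj_comp z
    have hU : ∀ f : ℂ → ℂ, (dzbar fun w => conj (f w)) = fun w => conj (dz f w) :=
      fun f => funext fun w => dzbar_conj_comp w
    have hU1 : (dzbar fun w => Utilde C w t) = fun w => conj (dz (fun w => Utilde C w t) w) := by
      rw [← hU]; simp only [conj_Utilde]
    have key : dz (dz (dz fun w => Utilde C w t)) z
        + 3 * dz (fun w => Utilde C w t) z * Vtilde C z t
        + 3 / 2 * Utilde C z t * dz (fun w => Vtilde C w t) z =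
      (tau z (conj z) ((t - C : ℝ) : ℂ) ^ 2 * (-conj z) + tau z (conj z) ((t - C : ℝ) : ℂ) *
        (-3 * (-(z * conj z + 1)) * tauZ z (conj z) ((t - C : ℝ) : ℂ)
          + num z (conj z) ((t - C : ℝ) : ℂ) * (2 * cubic (conj z) z ((t - C : ℝ) : ℂ)) / 2)
        + 3 * tauZ z (conj z) ((t - C : ℝ) : ℂ) * (numZ z (conj z) ((t - C : ℝ) : ℂ)
            * tauZ z (conj z) ((t - C : ℝ) : ℂ)
          - num z (conj z) ((t - C : ℝ) : ℂ) * tauZZ z (conj z) ((t - C : ℝ) : ℂ) / 2))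
        / tau z (conj z) ((t - C : ℝ) : ℂ) ^ 3 := by
      simp only [Utilde_eq, Vtilde_eq]
      rw [dz_dz_dz_U h0, (hasWirtingerAt_U h0).dz_eq, (hasWirtingerAt_V h0).dz_eq]
      exact thirdDeriv_add _ _ _ _ _ _ _ _ h0
    -- As Ũ is real, every ∂_z̄ of it is the conjugate of a ∂_z, so the second half of the equation
    -- is the conjugate of the first.
    have key' : dzbar (dzbar (dzbar fun w => Utilde C w t)) z
        + 3 * dzbar (fun w => Utilde C w t) z * conj (Vtilde C z t)
        + 3 / 2 * Utilde C z t * dzbar (fun w => conj (Vtilde C w t)) z =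
      conj (dz (dz (dz fun w => Utilde C w t)) z
        + 3 * dz (fun w => Utilde C w t) z * Vtilde C z t
        + 3 / 2 * Utilde C z t * dz (fun w => Vtilde C w t) z) := by
      rw [hV, hU1, hU, hU]
      simp only [map_add, map_mul, map_div₀, map_ofNat, conj_Utilde]
    rw [key', key, (hasDerivAt_Utilde_time h).deriv]
    simp only [map_add, map_sub, map_mul, map_div₀, map_pow, map_neg, map_one, map_ofNat, conj_tau,
      conj_tauZ, conj_tauZZ, conj_num, conj_numZ, conj_cubic, Complex.conj_conj,
      Complex.conj_ofReal]
    generalize ((t - C : ℝ) : ℂ) = s at *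
    have e := hirota_identity z (conj z) s
    generalize conj z = w at *
    rw [tau_symm z w s, num_symm z w s, ← add_div, div_eq_div_iff (pow_ne_zero 2 h0)
      (pow_ne_zero 3 h0)]
    linear_combination tau z w s ^ 2 * e

/-! ### The Enneper surface and the Moutard transformation -/

lemma enneper_zero (C t : ℝ) (z : ℂ) : (enneper C t z 0 : ℂ) =
    Complex.I / 2 * (cubic z (conj z) 0 - cubic (conj z) z 0) := by
  apply Complex.ext <;> simp [enneper, cubic, pow_succ] <;> ring

lemma enneper_one (C t : ℝ) (z : ℂ) : (enneper C t z 1 : ℂ) =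
    -(1 / 2) * (cubic z (conj z) ((t - C : ℝ) : ℂ) + cubic (conj z) z ((t - C : ℝ) : ℂ)) := by
  apply Complex.ext <;> simp [enneper, cubic, pow_succ] <;> ring

lemma enneper_two (C t : ℝ) (z : ℂ) : (enneper C t z 2 : ℂ) = quad z (conj z) := by
  apply Complex.ext <;> simp [enneper, quad, pow_succ]
  ring

lemma isWeierstrassSurface_enneper (C t : ℝ) :
    IsWeierstrassSurface (fun z => z) (fun _ => 1) (enneper C t) := by
  have h0 : ∀ z, HasWirtingerAt (fun z => (enneper C t z 0 : ℂ)) (Complex.I / 2 * (z ^ 2 + 1))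
      (-(Complex.I / 2) * (conj z ^ 2 + 1)) z := by
    intro z
    simp only [enneper_zero]
    refine ((HasWirtingerAt.const (Complex.I / 2) z).mul ((hasWirtingerAt_cubic z 0).sub
      (hasWirtingerAt_cubic' z 0))).congr_values ?_ ?_ <;> ring
  have h1 : ∀ z, HasWirtingerAt (fun z => (enneper C t z 1 : ℂ)) (1 / 2 * (1 - z ^ 2))
      (1 / 2 * (1 - conj z ^ 2)) z := by
    intro z
    simp only [enneper_one]
    refine ((HasWirtingerAt.const (-(1 / 2)) z).mul ((hasWirtingerAt_cubic z _).add
      (hasWirtingerAt_cubic' z _))).congr_values ?_ ?_ <;> ring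
  have h2 : ∀ z, HasWirtingerAt (fun z => (enneper C t z 2 : ℂ)) z (conj z) z := by
    intro z
    simp only [enneper_two]
    exact hasWirtingerAt_quad z
  -- The Wirtinger formulas concern the complex-valued coercions; real parts bring differentiability
  -- back to the coordinates themselves.
  have hre : ∀ i, (∀ z, DifferentiableAt ℝ (fun z => (enneper C t z i : ℂ)) z) →
      Differentiable ℝ (fun z => enneper C t z i) := fun i h z =>
    (Complex.reCLM.differentiableAt.comp z (h z) :)
  refine ⟨differentiable_id, by simp, ?_, ?_, ?_, ?_, ?_, ?_, ?_⟩
  · rw [differentiable_pi]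
    intro i
    apply hre
    intro z
    fin_cases i
    exacts [(h0 z).differentiableAt, (h1 z).differentiableAt, (h2 z).differentiableAt]
  · intro z; rw [(h0 z).dz_eq]; simp
  · intro z; rw [(h0 z).dzbar_eq]; simp
  · intro z; rw [(h1 z).dz_eq]; simp
  · intro z; rw [(h1 z).dzbar_eq]; simp
  · intro z; rw [(h2 z).dz_eq]; simp
  · intro z; rw [(h2 z).dzbar_eq]; simp

lemma enneperS_eq_su2 (C : ℝ) (z : ℂ) (t : ℝ) : enneperS C z t = su2 (enneper C t z) := by
  ext i j
  fin_cases i <;> fin_cases j <;> apply Complex.ext <;>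
    simp [enneperS, su2, enneper, gam, del, pow_two, map_ofNat]

/-- The matrix `Ψ` defining the transformation. -/
abbrev enneperPsi : MatFun := spinorMatrix (fun z _ => z) (fun _ _ => 1)

lemma enneperPsi_apply (z : ℂ) (t : ℝ) : enneperPsi z t = !![z, -1; 1, conj z] := by
  simp [spinorMatrix]

lemma hasWirtingerAt_enneperPsi (z : ℂ) (t : ℝ) (i j : Fin 2) :
    HasWirtingerAt (fun w => enneperPsi w t i j)
      ((!![1, 0; 0, 0] : Matrix (Fin 2) (Fin 2) ℂ) i j)
      ((!![0, 0; 0, 1] : Matrix (Fin 2) (Fin 2) ℂ) i j) z := by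
  simp only [enneperPsi_apply]
  fin_cases i <;> fin_cases j
  exacts [.id z, .const _ z, .const _ z, .conjugate z]

lemma matDy_enneperPsi :
    matDy enneperPsi = fun _ _ => !![Complex.I, 0; 0, -Complex.I] := by
  ext z t i j
  rw [matDy, Matrix.of_apply, (hasWirtingerAt_enneperPsi z t i j).dy_eq]
  fin_cases i <;> fin_cases j <;> simp

lemma matDy_const (A : Matrix (Fin 2) (Fin 2) ℂ) : matDy (fun _ _ => A) = fun _ _ => 0 := by
  ext z t i j
  rw [matDy, Matrix.of_apply, (HasWirtingerAt.const (A i j) z).dy_eq]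
  simp

lemma Gam_inv : Gam⁻¹ = !![0, -1; 1, 0] := by
  rw [Gam, Matrix.inv_def, Matrix.det_fin_two_of, Matrix.adjugate_fin_two_of]
  simp

/-- In the dt-component Ψ_yy = 0 and Ψ_y is constant, so only the constant matrix diag(i, -i) is
left. It gives δ_t = -i and γ_t = 0: the surface moves with unit speed along the u²-axis. -/
lemma isMoutardPrimitive_enneperS (C : ℝ) : IsMoutardPrimitive enneperPsi (enneperS C) := by
  have hg : ∀ z, HasWirtingerAt gam (Complex.I * z) (Complex.I * conj z) z := by
    intro z
    have : gam = fun z => Complex.I * quad z (conj z) := funext gam_eq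
    rw [this]
    refine ((HasWirtingerAt.const Complex.I z).mul (hasWirtingerAt_quad z)).congr_values ?_ ?_ <;>
      ring
  have hd : ∀ z t, HasWirtingerAt (fun z => del C z t) (-Complex.I) (Complex.I * conj z ^ 2) z := by
    intro z t
    simp only [del_eq]
    refine ((HasWirtingerAt.const Complex.I z).mul (hasWirtingerAt_cubic' z _)).congr_values ?_ ?_
      <;> ring
  have hS : ∀ z t i j, HasWirtingerAt (fun z => enneperS C z t i j)
      ((!![Complex.I * z, -Complex.I; Complex.I * z ^ 2, -(Complex.I * z)] :
        Matrix (Fin 2) (Fin 2) ℂ) i j)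
      ((!![Complex.I * conj z, Complex.I * conj z ^ 2; -Complex.I, -(Complex.I * conj z)] :
        Matrix (Fin 2) (Fin 2) ℂ) i j) z := by
    intro z t i j
    fin_cases i <;> fin_cases j
    · exact hg z
    · exact hd z t
    · exact (hd z t).conj_comp.neg.congr_values (by simp) (by simp)
    · exact (hg z).conj_comp.congr_values (by simp) (by simp)
  have ht : ∀ z t, HasDerivAt (fun s : ℝ => del C z s) (-Complex.I) t := by
    intro z t
    simp only [del_eq, cubic]
    have hs : HasDerivAt (fun s : ℝ => ((s - C : ℝ) : ℂ)) 1 t := by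
      simpa using (((hasDerivAt_id t).sub_const C).ofReal_comp)
    simpa using (hs.const_sub (conj z ^ 3 / 3 - z)).const_mul Complex.I
  refine ⟨fun z t i j => ?_, fun z t i j => ?_, fun z t i j => ?_⟩
  · refine (hS z t i j).hasDerivAt_horizontal.congr_deriv ?_
    rw [omegaX, enneperPsi_apply]
    fin_cases i <;> fin_cases j <;>
      simp [Gam, sigma3, Matrix.mul_apply, Fin.sum_univ_two, Matrix.transpose_apply] <;> ring
  · refine (hS z t i j).hasDerivAt_vertical.congr_deriv ?_
    rw [omegaY, enneperPsi_apply]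
    have hI := Complex.I_mul_I
    fin_cases i <;> fin_cases j <;>
      simp [Gam, Matrix.mul_apply, Fin.sum_univ_two, Matrix.transpose_apply]
    · linear_combination (z - conj z) * hI
    · linear_combination (-1 - conj z ^ 2) * hI
    · linear_combination (z ^ 2 + 1) * hI
    · linear_combination (conj z - z) * hI
  · have h1 : omegaT enneperPsi z t = !![Complex.I, 0; 0, -Complex.I] := by
      rw [omegaT, matDy_enneperPsi, matDy_const]
      ext i j
      fin_cases i <;> fin_cases j <;>
        simp [sigma3, Matrix.mul_apply, Fin.sum_univ_two, Matrix.transpose_apply]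
    rw [h1]
    fin_cases i <;> fin_cases j
    · simpa [enneperS, Gam] using hasDerivAt_const t (gam z)
    · simpa [enneperS, Gam] using ht z t
    · have := (Complex.conjCLE : ℂ →L[ℝ] ℂ).hasFDerivAt.comp_hasDerivAt t (ht z t)
      refine this.neg.congr_deriv ?_
      simp [Gam]
    · simpa [enneperS, Gam] using hasDerivAt_const t (conj (gam z))

lemma det_enneperS (C : ℝ) (z : ℂ) (t : ℝ) :
    (enneperS C z t).det = tau z (conj z) ((t - C : ℝ) : ℂ) := by
  rw [enneperS, Matrix.det_fin_two_of, conj_gam, conj_del, gam_eq, del_eq, tau]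
  linear_combination (-quad z (conj z) ^ 2
    - cubic (conj z) z ((t - C : ℝ) : ℂ) * cubic z (conj z) ((t - C : ℝ) : ℂ)) * Complex.I_sq

lemma det_enneperPsi (z : ℂ) (t : ℝ) : (enneperPsi z t).det = 1 + z * conj z := by
  rw [enneperPsi_apply, Matrix.det_fin_two_of]; ring

lemma moutardK_enneper (C : ℝ) (z : ℂ) (t : ℝ) :
    moutardK enneperPsi (enneperS C) z t =
      !![Complex.I * Utilde C z t, aCoef C z t;
        -conj (aCoef C z t), -(Complex.I * Utilde C z t)] := by
  have hc : conj (aCoef C z t) = Complex.I * tauZ (conj z) z ((t - C : ℝ) : ℂ)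
      / tau z (conj z) ((t - C : ℝ) : ℂ) := by
    rw [aCoef_eq]
    simp [conj_tauZ, conj_tau, -Complex.ofReal_sub, tau_symm z]
  rw [hc, moutardK, Gam_inv, Matrix.inv_def, det_enneperS, Ring.inverse_eq_inv', enneperS,
    Matrix.adjugate_fin_two_of, enneperPsi_apply, Gam, Utilde_eq, aCoef_eq, conj_gam, conj_del,
    gam_eq, del_eq]
  generalize ((t - C : ℝ) : ℂ) = s
  generalize conj z = w
  have ht : (!![z, -1; 1, w]).transpose = !![z, 1; -1, w] := by
    ext i j; fin_cases i <;> fin_cases j <;> rfl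
  rw [ht]
  ext i j
  fin_cases i <;> fin_cases j <;>
    simp [Matrix.mul_apply, Fin.sum_univ_two, num, tauZ, quad, cubic] <;>
    ring

lemma moutardM_enneper (z : ℂ) (t : ℝ) :
    moutardM enneperPsi z t =
      !![-Complex.I * z / (1 + z * conj z), -Complex.I / (1 + z * conj z);
        -conj (-Complex.I / (1 + z * conj z)), conj (-Complex.I * z / (1 + z * conj z))] := by
  rw [moutardM, Gam_inv, Matrix.inv_def, det_enneperPsi, Ring.inverse_eq_inv', matDy_enneperPsi,
    enneperPsi_apply, Matrix.adjugate_fin_two_of, Gam]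
  ext i j
  fin_cases i <;> fin_cases j <;>
    simp [Matrix.mul_apply, Fin.sum_univ_two] <;> ring

lemma isMoutardTransformOfZero_enneper (C : ℝ) :
    IsMoutardTransformOfZero {((0 : ℂ), C)}ᶜ
      (spinorMatrix (fun z _ => z) (fun _ _ => 1)) (enneperS C) (Utilde C) (Vtilde C) where
  smooth i j := by
    simp only [enneperPsi_apply]
    fin_cases i <;> fin_cases j
    · exact contDiff_fst
    · exact contDiff_const
    · exact contDiff_const
    · exact ((Complex.conjCLE : ℂ →L[ℝ] ℂ).comp (ContinuousLinearMap.fst ℝ ℂ ℝ)).contDiff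
  dirac₀ z t j := by
    rw [(hasWirtingerAt_enneperPsi z t 1 j).dz_eq]
    fin_cases j <;> rfl
  dirac₁ z t j := by
    rw [(hasWirtingerAt_enneperPsi z t 0 j).dzbar_eq]
    fin_cases j <;> rfl
  evolution z t i j := by
    -- Ψ is independent of t and affine in z and z̄, so both sides of the evolution equation vanish.
    have h1 : (dz fun w => enneperPsi w t i j)
        = fun _ => (!![1, 0; 0, 0] : Matrix (Fin 2) (Fin 2) ℂ) i j :=
      funext fun w => (hasWirtingerAt_enneperPsi w t i j).dz_eq
    have h2 : (dzbar fun w => enneperPsi w t i j)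
        = fun _ => (!![0, 0; 0, 1] : Matrix (Fin 2) (Fin 2) ℂ) i j :=
      funext fun w => (hasWirtingerAt_enneperPsi w t i j).dzbar_eq
    have h3 : ∀ c, dz (fun _ => c) = fun _ => 0 :=
      fun c => funext fun w => (HasWirtingerAt.const c w).dz_eq
    have h4 : ∀ c, dzbar (fun _ => c) = fun _ => 0 :=
      fun c => funext fun w => (HasWirtingerAt.const c w).dzbar_eq
    rw [h1, h2, h3, h4, h3, h4]
    simp only [enneperPsi_apply, deriv_const, add_zero]
  primitive := isMoutardPrimitive_enneperS C
  isUnit_S z t h := by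
    rw [Matrix.isUnit_iff_isUnit_det, det_enneperS, isUnit_iff_ne_zero]
    exact tau_ne_zero h
  isUnit_Ψ z t _ := by
    rw [Matrix.isUnit_iff_isUnit_det, det_enneperPsi, isUnit_iff_ne_zero]
    exact one_add_mul_conj_ne_zero z
  transform z t _ := by
    -- Here b = -i z/(1 + |z|²) and c = -i/(1 + |z|²), read off from `moutardM_enneper`; W is the
    -- real rational form of Ũ.
    refine ⟨Urat C z.re z.im t, aCoef C z t, _, _, ?_, moutardM_enneper z t,
      Utilde_eq_Urat C z t, ?_⟩
    · rw [moutardK_enneper, Utilde_eq_Urat]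
    · rw [← Utilde_eq_Urat, Vtilde]
      have h1 : ((1 + ‖z‖ ^ 2 : ℝ) : ℂ) = 1 + z * conj z := by
        rw [Complex.mul_conj']; push_cast; rfl
      rw [h1]
      simp only [map_div₀, map_neg, map_mul, map_add, map_one, Complex.conj_I, Complex.conj_conj]
      rw [mul_comm (conj z) z]
      linear_combination (2 * Utilde C z t / (1 + z * conj z)) * Complex.I_mul_I

/-! ### Decay at infinity -/

/-- `f` grows at most like `‖z‖ ^ n` at infinity. -/
def GrowthLE (n : ℕ) (f : ℂ → ℂ) : Prop :=
  f =O[cocompact ℂ] fun z : ℂ => ‖z‖ ^ n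

namespace GrowthLE

variable {f g : ℂ → ℂ} {m n : ℕ}

lemma mono (hf : GrowthLE m f) (h : m ≤ n) : GrowthLE n f := by
  refine IsBigO.trans hf (IsBigO.of_bound 1 ?_)
  filter_upwards [(tendsto_norm_cocompact_atTop (E := ℂ)).eventually_ge_atTop 1] with z hz
  rw [norm_pow, norm_pow, norm_norm, one_mul]
  exact pow_le_pow_right₀ hz h

protected lemma const (c : ℂ) : GrowthLE 0 fun _ => c := by
  simpa [GrowthLE] using isBigO_const_const c (one_ne_zero (α := ℝ)) (cocompact ℂ)

protected lemma id : GrowthLE 1 fun z => z := by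
  simpa [GrowthLE] using (isBigO_refl (fun z : ℂ => z) (cocompact ℂ)).norm_right

protected lemma conjugate : GrowthLE 1 fun z => conj z := by
  refine IsBigO.of_bound 1 (Eventually.of_forall fun z => ?_)
  simp

lemma mul (hf : GrowthLE m f) (hg : GrowthLE n g) : GrowthLE (m + n) fun z => f z * g z := by
  simpa only [GrowthLE, pow_add] using IsBigO.mul hf hg

lemma add (hf : GrowthLE m f) (hg : GrowthLE n g) : GrowthLE (max m n) fun z => f z + g z :=
  IsBigO.add (hf.mono (le_max_left m n)) (hg.mono (le_max_right m n))

lemma neg (hf : GrowthLE m f) : GrowthLE m fun z => -f z :=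
  IsBigO.neg_left hf

lemma sub (hf : GrowthLE m f) (hg : GrowthLE n g) : GrowthLE (max m n) fun z => f z - g z := by
  simpa only [sub_eq_add_neg] using hf.add hg.neg

lemma pow (hf : GrowthLE m f) (k : ℕ) : GrowthLE (m * k) fun z => f z ^ k := by
  simpa only [GrowthLE, pow_mul] using IsBigO.pow hf k

end GrowthLE

section growth

variable (s : ℂ)

lemma growthLE_quad : GrowthLE 2 fun z => quad z (conj z) := by
  simp only [quad, div_eq_mul_inv]
  exact ((GrowthLE.id.pow 2).add (GrowthLE.conjugate.pow 2)).mul (.const _)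

lemma growthLE_cubic : GrowthLE 3 fun z => cubic z (conj z) s := by
  simp only [cubic, div_eq_mul_inv]
  exact (((GrowthLE.id.pow 3).mul (.const _)).sub .conjugate).sub (.const s)

lemma growthLE_cubic' : GrowthLE 3 fun z => cubic (conj z) z s := by
  simp only [cubic, div_eq_mul_inv]
  exact (((GrowthLE.conjugate.pow 3).mul (.const _)).sub .id).sub (.const s)

/-- In these degree counts the exponent built from sums, products and maxima of numerals evaluates
definitionally to the stated one. -/
lemma growthLE_tau : GrowthLE 6 fun z => tau z (conj z) s :=
  (growthLE_quad.pow 2).add ((growthLE_cubic s).mul (growthLE_cubic' s))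

lemma growthLE_tauZ : GrowthLE 5 fun z => tauZ z (conj z) s :=
  ((((GrowthLE.const 2).mul growthLE_quad).mul .id).add
    ((GrowthLE.id.pow 2).mul (growthLE_cubic' s))).sub (growthLE_cubic s)

lemma growthLE_tauZZ : GrowthLE 4 fun z => tauZZ z (conj z) s :=
  ((GrowthLE.const 2).mul growthLE_quad).add
    (((GrowthLE.const 2).mul .id).mul (growthLE_cubic' s))

lemma growthLE_num : GrowthLE 4 fun z => num z (conj z) s := by
  simp only [num, div_eq_mul_inv]
  have h := (GrowthLE.id.pow 2).add (GrowthLE.conjugate.pow 2)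
  exact (((((GrowthLE.id.mul .conjugate).mul h).mul (.const _)).add (h.mul (.const _))).add
    ((GrowthLE.const s).mul (GrowthLE.id.add .conjugate))).neg

/-- `z ∂_z log τ → 3` at infinity. -/
lemma growthLE_mul_tauZ_sub :
    GrowthLE 4 fun z => z * tauZ z (conj z) s - 3 * tau z (conj z) s := by
  -- Substituting z³ = 3 (`cubic z w s` + w + s) in z τ_z makes the degree-6 product of the two
  -- cubics cancel against 3τ.
  have h : (fun z => z * tauZ z (conj z) s - 3 * tau z (conj z) s) = fun z =>
      2 * quad z (conj z) * z ^ 2 + 3 * (conj z + s) * cubic (conj z) z s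
        - z * cubic z (conj z) s - 3 * quad z (conj z) ^ 2 := by
    funext z
    simp only [tau, tauZ, cubic]
    ring
  rw [h]
  exact (((((GrowthLE.const 2).mul growthLE_quad).mul (GrowthLE.id.pow 2)).add
    (((GrowthLE.const 3).mul (GrowthLE.conjugate.add (.const s))).mul (growthLE_cubic' s))).sub
    (GrowthLE.id.mul (growthLE_cubic s))).sub ((GrowthLE.const 3).mul (growthLE_quad.pow 2))

end growth

lemma norm_tau (C : ℝ) (z : ℂ) (t : ℝ) : ‖tau z (conj z) ((t - C : ℝ) : ℂ)‖ = den C z t := by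
  rw [← den_eq, Complex.norm_real, Real.norm_of_nonneg]
  unfold den
  positivity

lemma norm_pow_six_isBigO_tau (C t : ℝ) :
    (fun z : ℂ => ‖z‖ ^ 6) =O[cocompact ℂ] fun z => tau z (conj z) ((t - C : ℝ) : ℂ) := by
  -- For r = |z| ≥ 6 + |t - C| one has |δ| ≥ r³/3 - r - |t - C| ≥ r³/3 - 2r ≥ r³/6, because r ≥ |t -
  -- C| and r³ ≥ 36 r. Squaring gives 36.
  refine IsBigO.of_bound 36 ?_
  filter_upwards [(tendsto_norm_cocompact_atTop (E := ℂ)).eventually_ge_atTop (6 + |t - C|)]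
    with z hz
  rw [norm_tau, norm_pow, norm_norm]
  have h1 : ‖z‖ ^ 3 / 6 ≤ ‖del C z t‖ := by
    rw [del_eq, norm_mul, Complex.norm_I, one_mul, cubic]
    have e1 : ‖conj z ^ 3 / 3‖ = ‖z‖ ^ 3 / 3 := by simp
    have e2 : ‖((t - C : ℝ) : ℂ)‖ = |t - C| := Complex.norm_real _
    have e3 := norm_sub_norm_le (conj z ^ 3 / 3 - z) ((t - C : ℝ) : ℂ)
    have e4 := norm_sub_norm_le (conj z ^ 3 / 3) z
    have e5 := abs_nonneg (t - C)
    have e6 : 36 * ‖z‖ ≤ ‖z‖ ^ 3 := by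
      have : 6 ^ 2 ≤ ‖z‖ ^ 2 := by gcongr; linarith
      nlinarith
    linarith
  have h2 : (‖z‖ ^ 3 / 6) ^ 2 ≤ ‖del C z t‖ ^ 2 := by gcongr
  have h3 := sq_nonneg ‖gam z‖
  have h4 : (‖z‖ ^ 3 / 6) ^ 2 = ‖z‖ ^ 6 / 36 := by ring
  unfold den
  linarith

lemma GrowthLE.div_isBigO {f g : ℂ → ℂ} {m n : ℕ} (hf : GrowthLE m f)
    (hg : (fun z : ℂ => ‖z‖ ^ (m + n)) =O[cocompact ℂ] g) :
    (fun z => f z / g z) =O[cocompact ℂ] fun z : ℂ => (‖z‖ ^ n)⁻¹ := by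
  have hpos := (tendsto_norm_cocompact_atTop (E := ℂ)).eventually_gt_atTop 0
  have h1 := hg.inv_rev (hpos.mono fun z hz h0 => absurd h0 (by positivity))
  have h2 := IsBigO.mul hf h1
  simp only [div_eq_mul_inv]
  refine h2.congr' .rfl ?_
  filter_upwards [hpos] with z hz
  rw [pow_add]
  field_simp

lemma Utilde_isBigO (C t : ℝ) :
    (fun z : ℂ => Utilde C z t) =O[cocompact ℂ] (fun z : ℂ => (‖z‖ ^ 2)⁻¹) := by
  simp only [Utilde_eq]
  exact (growthLE_num _).div_isBigO (norm_pow_six_isBigO_tau C t)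

lemma Vtilde_isBigO (C t : ℝ) :
    (fun z : ℂ => Vtilde C z t) =O[cocompact ℂ] (fun z : ℂ => (‖z‖ ^ 2)⁻¹) := by
  simp only [Vtilde_eq]
  have h1 : GrowthLE 10 fun z => tauZZ z (conj z) ((t - C : ℝ) : ℂ)
      * tau z (conj z) ((t - C : ℝ) : ℂ) - tauZ z (conj z) ((t - C : ℝ) : ℂ) ^ 2 :=
    ((growthLE_tauZZ _).mul (growthLE_tau _)).sub ((growthLE_tauZ _).pow 2)
  refine h1.div_isBigO ?_
  simpa only [← pow_mul] using (norm_pow_six_isBigO_tau C t).pow 2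

/-! ### The singular point -/

/-- At t = C both numerator and denominator of the rational formula are divisible by r². Cancelling
it leaves a function of r continuous at 0, with denominator 9 there. -/
lemma Utilde_polar (C r φ : ℝ) (hr : r ≠ 0) :
    Utilde C (r * Complex.exp (φ * Complex.I)) C =
      ((-(3 * (r ^ 2 + 3) * Real.cos (2 * φ)) / (r ^ 4 + r ^ 2 *
        (3 * (Real.cos φ ^ 4 + Real.sin φ ^ 4) + 18 * Real.cos φ ^ 2 * Real.sin φ ^ 2) + 9) : ℝ) : ℂ)
      := by
  rw [Utilde_eq_Urat, Urat, Qpoly]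
  congr 1
  rw [Complex.re_ofReal_mul, Complex.im_ofReal_mul, Complex.exp_ofReal_mul_I_re,
    Complex.exp_ofReal_mul_I_im, Real.cos_two_mul']
  have hcs := Real.cos_sq_add_sin_sq φ
  set c := Real.cos φ
  set s := Real.sin φ
  have e1 : (r * c) ^ 2 + (r * s) ^ 2 = r ^ 2 := by linear_combination r ^ 2 * hcs
  have hpos : 0 < r ^ 4 + r ^ 2 * (3 * (c ^ 4 + s ^ 4) + 18 * c ^ 2 * s ^ 2) + 9 := by positivity
  rw [e1]
  rw [div_eq_div_iff _ hpos.ne']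
  · ring
  · have : (r ^ 2) ^ 3 + 3 * ((r * c) ^ 4 + (r * s) ^ 4) + 18 * (r * c) ^ 2 * (r * s) ^ 2 + 9 * r ^ 2
        + 9 * (C - C) ^ 2 + (6 * (r * c) ^ 3 - 18 * (r * c) * (r * s) ^ 2 - 18 * (r * c)) * (C - C)
      = r ^ 2 * (r ^ 4 + r ^ 2 * (3 * (c ^ 4 + s ^ 4) + 18 * c ^ 2 * s ^ 2) + 9) := by ring
    rw [this]
    positivity

lemma tendsto_Utilde_radial (C φ : ℝ) :
    Tendsto (fun r : ℝ => Utilde C (r * Complex.exp (φ * Complex.I)) C)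
      (𝓝[>] 0) (𝓝 (-(Real.cos (2 * φ) : ℂ))) := by
  have h : Tendsto (fun r : ℝ => (-(3 * (r ^ 2 + 3) * Real.cos (2 * φ)) / (r ^ 4 + r ^ 2 *
      (3 * (Real.cos φ ^ 4 + Real.sin φ ^ 4) + 18 * Real.cos φ ^ 2 * Real.sin φ ^ 2) + 9) : ℝ))
      (𝓝 0) (𝓝 (-(3 * (0 ^ 2 + 3) * Real.cos (2 * φ)) / (0 ^ 4 + 0 ^ 2 *
      (3 * (Real.cos φ ^ 4 + Real.sin φ ^ 4) + 18 * Real.cos φ ^ 2 * Real.sin φ ^ 2) + 9))) := by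
    refine ContinuousAt.tendsto (f := fun r : ℝ => (-(3 * (r ^ 2 + 3) * Real.cos (2 * φ)) /
      (r ^ 4 + r ^ 2 * (3 * (Real.cos φ ^ 4 + Real.sin φ ^ 4)
        + 18 * Real.cos φ ^ 2 * Real.sin φ ^ 2) + 9) : ℝ)) (ContinuousAt.div ?_ ?_ ?_)
    · fun_prop
    · fun_prop
    · norm_num
  have e : -(3 * (0 ^ 2 + 3) * Real.cos (2 * φ)) / (0 ^ 4 + 0 ^ 2 *
      (3 * (Real.cos φ ^ 4 + Real.sin φ ^ 4) + 18 * Real.cos φ ^ 2 * Real.sin φ ^ 2) + 9)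
      = -Real.cos (2 * φ) := by ring
  rw [e] at h
  rw [← Complex.ofReal_neg]
  refine ((Complex.continuous_ofReal.tendsto _).comp (h.mono_left nhdsWithin_le_nhds)).congr' ?_
  filter_upwards [self_mem_nhdsWithin] with r hr
  exact (Utilde_polar C r φ (ne_of_gt hr)).symm

lemma tendsto_time_axis (C : ℝ) :
    Tendsto (fun s : ℝ => ((0 : ℂ), C + s)) (𝓝[>] 0) (𝓝[≠] ((0 : ℂ), C)) := by
  refine tendsto_nhdsWithin_iff.2 ⟨?_, ?_⟩
  · have : Continuous fun s : ℝ => ((0 : ℂ), C + s) := by fun_prop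
    simpa using (this.tendsto 0).mono_left nhdsWithin_le_nhds
  · filter_upwards [self_mem_nhdsWithin] with s hs
    simpa using ne_of_gt hs

lemma tendsto_real_axis (C : ℝ) :
    Tendsto (fun r : ℝ => ((r : ℂ) * Complex.exp ((0 : ℝ) * Complex.I), C)) (𝓝[>] 0)
      (𝓝[≠] ((0 : ℂ), C)) := by
  refine tendsto_nhdsWithin_iff.2 ⟨?_, ?_⟩
  · have : Continuous fun r : ℝ => ((r : ℂ) * Complex.exp ((0 : ℝ) * Complex.I), C) := by fun_prop
    simpa using (this.tendsto 0).mono_left nhdsWithin_le_nhds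
  · filter_upwards [self_mem_nhdsWithin] with s hs
    simpa using ne_of_gt hs

/-- Two approaches disagree: Ũ vanishes on the time axis z = 0, while along the positive real axis
at t = C it tends to -1. -/
lemma not_tendsto_Utilde (C : ℝ) :
    ¬ ∃ L : ℂ, Tendsto (fun p : ℂ × ℝ => Utilde C p.1 p.2) (𝓝[≠] ((0 : ℂ), C)) (𝓝 L) := by
  rintro ⟨L, hL⟩
  have h1 : L = 0 := by
    refine tendsto_nhds_unique (hL.comp (tendsto_time_axis C)) ?_
    refine tendsto_const_nhds.congr fun s => ?_
    simp [Utilde_eq, num]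
  have h2 := tendsto_nhds_unique (hL.comp (tendsto_real_axis C)) (tendsto_Utilde_radial C 0)
  rw [h1] at h2
  simp at h2

/-- On the time axis, at t = C + s, one has τ = s², τ_z = s and τ_zz = 0, hence Ṽ = -1/s², which is
unbounded. -/
lemma not_tendsto_Vtilde (C : ℝ) :
    ¬ ∃ L : ℂ, Tendsto (fun p : ℂ × ℝ => Vtilde C p.1 p.2) (𝓝[≠] ((0 : ℂ), C)) (𝓝 L) := by
  rintro ⟨L, hL⟩
  refine not_tendsto_nhds_of_tendsto_atTop ?_ _ (hL.comp (tendsto_time_axis C)).norm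
  have h : Tendsto (fun s : ℝ => (s⁻¹) ^ 2) (𝓝[>] 0) atTop :=
    (tendsto_pow_atTop two_ne_zero).comp tendsto_inv_nhdsGT_zero
  refine h.congr' ?_
  filter_upwards [self_mem_nhdsWithin] with s hs
  have hs : s ≠ 0 := ne_of_gt hs
  have : Vtilde C 0 (C + s) = ((-(s⁻¹) ^ 2 : ℝ) : ℂ) := by
    have hs' : (s : ℂ) ≠ 0 := by exact_mod_cast hs
    simp [Vtilde_eq, tauZZ, tauZ, tau, quad, cubic]
    field_simp
  simp only [Function.comp_apply]
  rw [this, Complex.norm_real]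
  simp

/-! ### Integration over the plane by flux through circles -/

/-- Polar coordinates `(r, θ) ↦ r e^{iθ}`. -/
def polar (p : ℝ × ℝ) : ℂ := p.1 * Complex.exp (p.2 * Complex.I)

lemma norm_polar (p : ℝ × ℝ) : ‖polar p‖ = |p.1| := by
  rw [polar, norm_mul, Complex.norm_exp_ofReal_mul_I, mul_one, Complex.norm_real, Real.norm_eq_abs]

lemma polar_ne_zero {p : ℝ × ℝ} (h : p.1 ≠ 0) : polar p ≠ 0 := by
  rw [← norm_pos_iff, norm_polar]; exact abs_pos.2 h

lemma continuous_polar : Continuous polar := by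
  unfold polar; fun_prop

lemma polar_neg_pi (r : ℝ) : polar (r, -Real.pi) = polar (r, Real.pi) := by
  simp [polar, Complex.exp_neg]

lemma hasFDerivAt_exp_snd (p : ℝ × ℝ) :
    HasFDerivAt (fun p : ℝ × ℝ => Complex.exp (p.2 * Complex.I))
      ((Complex.exp (p.2 * Complex.I) * Complex.I) •
        (Complex.ofRealCLM.comp (ContinuousLinearMap.snd ℝ ℝ ℝ))) p := by
  have h1 : HasFDerivAt (fun p : ℝ × ℝ => (p.2 : ℂ))
      (Complex.ofRealCLM.comp (ContinuousLinearMap.snd ℝ ℝ ℝ)) p :=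
    (Complex.ofRealCLM.comp (ContinuousLinearMap.snd ℝ ℝ ℝ)).hasFDerivAt
  refine (h1.mul_const Complex.I).cexp.congr_fderiv ?_
  apply ContinuousLinearMap.ext
  intro x
  simp
  ring

lemma hasFDerivAt_polar (p : ℝ × ℝ) :
    HasFDerivAt polar
      ((Complex.exp (p.2 * Complex.I)) • (Complex.ofRealCLM.comp (ContinuousLinearMap.fst ℝ ℝ ℝ))
        + (p.1 * Complex.exp (p.2 * Complex.I) * Complex.I) •
        (Complex.ofRealCLM.comp (ContinuousLinearMap.snd ℝ ℝ ℝ))) p := by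
  have h1 : HasFDerivAt (fun p : ℝ × ℝ => (p.1 : ℂ))
      (Complex.ofRealCLM.comp (ContinuousLinearMap.fst ℝ ℝ ℝ)) p :=
    (Complex.ofRealCLM.comp (ContinuousLinearMap.fst ℝ ℝ ℝ)).hasFDerivAt
  refine (h1.mul (hasFDerivAt_exp_snd p)).congr_fderiv ?_
  apply ContinuousLinearMap.ext
  intro x
  simp
  ring

/-- The flux of `f` through the circle of radius `r` about the origin. -/
def flux (f : ℂ → ℂ) (r : ℝ) : ℂ := ∫ θ in (-Real.pi)..Real.pi, polar (r, θ) * f (polar (r, θ))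

/-- In polar coordinates ∂_r(r e^{iθ} f) + ∂_θ(i e^{iθ} f) = 2 r ∂f/∂z̄. The divergence theorem on
the rectangle [r₀, R] × [-π, π] then leaves only the sides r = r₀ and r = R, since the θ-component
takes equal values at ±π. -/
lemma integral_annulus_polar {f a b : ℂ → ℂ} (hf : ∀ z ≠ 0, HasWirtingerAt f (a z) (b z) z)
    (hb : ∀ z ≠ 0, ContinuousAt b z) {r₀ R : ℝ} (h0 : 0 < r₀) (hR : r₀ ≤ R) :
    ∫ r in r₀..R, ∫ θ in (-Real.pi)..Real.pi, 2 * (r : ℂ) * b (polar (r, θ)) =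
      flux f R - flux f r₀ := by
  have hfc : ∀ p : ℝ × ℝ, p.1 ≠ 0 → ContinuousAt (fun p => f (polar p)) p := fun p hp =>
    (hf _ (polar_ne_zero hp)).differentiableAt.continuousAt.comp continuous_polar.continuousAt
  have hbc : ∀ p : ℝ × ℝ, p.1 ≠ 0 → ContinuousAt (fun p => b (polar p)) p := fun p hp =>
    (hb _ (polar_ne_zero hp)).comp continuous_polar.continuousAt
  have hdf : ∀ p : ℝ × ℝ, p.1 ≠ 0 → HasFDerivAt (fun p => f (polar p))
      ((a (polar p) • (1 : ℂ →L[ℝ] ℂ) + b (polar p) • (Complex.conjCLE : ℂ →L[ℝ] ℂ)).comp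
        ((Complex.exp (p.2 * Complex.I)) • (Complex.ofRealCLM.comp (ContinuousLinearMap.fst ℝ ℝ ℝ))
        + (p.1 * Complex.exp (p.2 * Complex.I) * Complex.I) •
        (Complex.ofRealCLM.comp (ContinuousLinearMap.snd ℝ ℝ ℝ)))) p := fun p hp =>
    HasFDerivAt.comp p (hf _ (polar_ne_zero hp)) (hasFDerivAt_polar p)
  have hF : ∀ p : ℝ × ℝ, p.1 ≠ 0 →
      DifferentiableAt ℝ (fun p => polar p * f (polar p)) p := fun p hp =>
    ((hasFDerivAt_polar p).mul (hdf p hp)).differentiableAt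
  have hG : ∀ p : ℝ × ℝ, p.1 ≠ 0 → DifferentiableAt ℝ
      (fun p : ℝ × ℝ => Complex.I * (Complex.exp (p.2 * Complex.I) * f (polar p))) p := fun p hp =>
    (((hasFDerivAt_exp_snd p).mul (hdf p hp)).const_mul Complex.I).differentiableAt
  have key : ∀ p : ℝ × ℝ, p.1 ≠ 0 →
      fderiv ℝ (fun p => polar p * f (polar p)) p (1, 0) + fderiv ℝ
      (fun p : ℝ × ℝ => Complex.I * (Complex.exp (p.2 * Complex.I) * f (polar p))) p (0, 1)
      = 2 * (p.1 : ℂ) * b (polar p) := by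
    intro p hp
    have h1 := ((hasFDerivAt_polar p).mul (hdf p hp)).fderiv
    have h2 := (((hasFDerivAt_exp_snd p).mul (hdf p hp)).const_mul Complex.I).fderiv
    have hE : Complex.exp (p.2 * Complex.I) * conj (Complex.exp (p.2 * Complex.I)) = 1 := by
      rw [Complex.mul_conj', Complex.norm_exp_ofReal_mul_I]; simp
    have h1' : fderiv ℝ (fun p => polar p * f (polar p)) p (1, 0) = _ :=
      DFunLike.congr_fun h1 (1, 0)
    have h2' : fderiv ℝ (fun p : ℝ × ℝ => Complex.I * (Complex.exp (p.2 * Complex.I) *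
      f (polar p))) p (0, 1) = _ := DFunLike.congr_fun h2 (0, 1)
    rw [h1', h2']
    simp only [add_apply, smul_apply,
      ContinuousLinearMap.comp_apply, ContinuousLinearMap.coe_fst', ContinuousLinearMap.coe_snd',
      Complex.ofRealCLM_apply, one_apply_eq_self, ContinuousLinearEquiv.coe_coe,
      Complex.conjCLE_apply, smul_eq_mul, Complex.ofReal_one, Complex.ofReal_zero, mul_one,
      mul_zero, add_zero, zero_add, map_mul, Complex.conj_I, Complex.conj_ofReal]
    rw [show polar p = p.1 * Complex.exp (p.2 * Complex.I) from rfl] at *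
    have hI := Complex.I_mul_I
    generalize Complex.exp (p.2 * Complex.I) = E at *
    generalize conj E = E' at *
    generalize f _ = F
    generalize a _ = A
    generalize b _ = B
    linear_combination (2 * p.1 * B) * hE + (E * F + E * A * p.1 * E - E * E' * B * p.1) * hI
  have hne : ∀ p ∈ Set.uIcc r₀ R ×ˢ Set.uIcc (-Real.pi) Real.pi, p.1 ≠ 0 := by
    intro p hp
    rw [Set.uIcc_of_le hR] at hp
    exact (h0.trans_le hp.1.1).ne'
  have hne' : ∀ p ∈ Set.Ioo (min r₀ R) (max r₀ R) ×ˢ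
      Set.Ioo (min (-Real.pi) Real.pi) (max (-Real.pi) Real.pi), p.1 ≠ 0 := by
    intro p hp
    rw [min_eq_left hR] at hp
    exact (h0.trans hp.1.1).ne'
  have main := integral2_divergence_prod_of_hasFDerivAt
    (fun p => polar p * f (polar p))
    (fun p : ℝ × ℝ => Complex.I * (Complex.exp (p.2 * Complex.I) * f (polar p))) _ _
    r₀ (-Real.pi) R Real.pi
    (fun p hp => (hF p (hne p hp)).continuousAt.continuousWithinAt)
    (fun p hp => (hG p (hne p hp)).continuousAt.continuousWithinAt)
    (fun p hp => (hF p (hne' p hp)).hasFDerivAt) (fun p hp => (hG p (hne' p hp)).hasFDerivAt) (by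
      have hc : ContinuousOn (fun p : ℝ × ℝ => 2 * (p.1 : ℂ) * b (polar p))
          (Set.uIcc r₀ R ×ˢ Set.uIcc (-Real.pi) Real.pi) := fun p hp =>
        (ContinuousAt.mul (by fun_prop) (hbc p (hne p hp))).continuousWithinAt
      refine (hc.integrableOn_compact (isCompact_uIcc.prod isCompact_uIcc)).congr_fun
        (fun p hp => (key p (hne p hp)).symm)
        (measurableSet_uIcc.prod measurableSet_uIcc))
  have hlhs : ∫ r in r₀..R, ∫ θ in (-Real.pi)..Real.pi, 2 * (r : ℂ) * b (polar (r, θ)) =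
      ∫ r in r₀..R, ∫ θ in (-Real.pi)..Real.pi,
        (fderiv ℝ (fun p => polar p * f (polar p)) (r, θ) (1, 0) + fderiv ℝ
      (fun p : ℝ × ℝ => Complex.I * (Complex.exp (p.2 * Complex.I) * f (polar p))) (r, θ) (0, 1))
      := by
    refine intervalIntegral.integral_congr fun r hr => ?_
    refine intervalIntegral.integral_congr fun θ hθ => ?_
    exact (key (r, θ) (hne (r, θ) ⟨hr, hθ⟩)).symm
  rw [hlhs, main]
  have hper : ∀ r : ℝ, Complex.I * (Complex.exp ((-Real.pi : ℝ) * Complex.I)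
      * f (polar (r, -Real.pi))) =
      Complex.I * (Complex.exp ((Real.pi : ℝ) * Complex.I) * f (polar (r, Real.pi))) := by
    intro r
    rw [polar_neg_pi]
    congr 2
    simp [Complex.exp_neg]
  simp only [hper, sub_self, zero_add]
  rfl

/-- Convergence along `comap norm l` is uniform on circles, so it passes to the integral over θ.
Stating it for a filter of radii covers r → 0 and r → ∞ at once. -/
lemma tendsto_flux {f : ℂ → ℂ} {l : Filter ℝ} {c : ℂ} (hf : ∀ z ≠ 0, ContinuousAt f z)
    (hl : ∀ᶠ r in l, r ≠ 0 ∧ 0 ≤ r)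
    (h : Tendsto (fun z => z * f z) (comap norm l) (𝓝 c)) :
    Tendsto (flux f) l (𝓝 (2 * Real.pi * c)) := by
  rw [Metric.tendsto_nhds]
  intro ε hε
  have hpi := Real.pi_pos
  -- The θ-interval has length 2π, so this tolerance bounds the error by ε/2 < ε.
  have h1 := (Metric.tendsto_nhds.1 h) (ε / (4 * Real.pi)) (by positivity)
  rw [eventually_comap] at h1
  filter_upwards [h1, hl] with r hr hr0
  have hc : Continuous fun θ : ℝ => polar (r, θ) * f (polar (r, θ)) := by
    have hp : Continuous fun θ : ℝ => polar (r, θ) :=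
      continuous_polar.comp (by fun_prop)
    refine hp.mul (continuous_iff_continuousAt.2 fun θ => ?_)
    exact ContinuousAt.comp (f := fun θ : ℝ => polar (r, θ)) (hf _ (polar_ne_zero hr0.1))
      hp.continuousAt
  have e1 : flux f r - 2 * Real.pi * c =
      ∫ θ in (-Real.pi)..Real.pi, (polar (r, θ) * f (polar (r, θ)) - c) := by
    rw [intervalIntegral.integral_sub (hc.intervalIntegrable _ _) (by simp), flux,
      intervalIntegral.integral_const]
    simp only [Complex.real_smul]
    push_cast
    ring
  rw [dist_eq_norm, e1]
  have e2 := intervalIntegral.norm_integral_le_of_norm_le_const (a := -Real.pi) (b := Real.pi)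
    (f := fun θ => polar (r, θ) * f (polar (r, θ)) - c) (C := ε / (4 * Real.pi)) (by
      intro θ _
      have := hr (polar (r, θ)) (by rw [norm_polar]; exact abs_of_nonneg hr0.2)
      rw [dist_eq_norm] at this
      exact this.le)
  refine e2.trans_lt ?_
  have : |Real.pi - -Real.pi| = 2 * Real.pi := by rw [abs_of_pos] <;> linarith
  rw [this]
  field_simp
  linarith

/-- The annulus `r₀ < |z| ≤ R`. -/
def annulus (r₀ R : ℝ) : Set ℂ := {z | ‖z‖ ∈ Set.Ioc r₀ R}

lemma measurableSet_annulus (r₀ R : ℝ) : MeasurableSet (annulus r₀ R) :=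
  measurableSet_Ioc.preimage measurable_norm

lemma integrableOn_annulus {h : ℂ → ℝ} (hh : ∀ z ≠ 0, ContinuousAt h z) {r₀ : ℝ} (h0 : 0 < r₀)
    (R : ℝ) : IntegrableOn h (annulus r₀ R) := by
  have hK : IsCompact {z : ℂ | r₀ ≤ ‖z‖ ∧ ‖z‖ ≤ R} := by
    refine (isCompact_closedBall (0 : ℂ) R).of_isClosed_subset ?_ ?_
    · exact (isClosed_le continuous_const continuous_norm).inter
        (isClosed_le continuous_norm continuous_const)
    · intro z hz
      simpa using hz.2
  refine IntegrableOn.mono_set (ContinuousOn.integrableOn_compact hK fun z hz => ?_)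
    (fun z hz => ⟨hz.1.le, hz.2⟩)
  exact (hh z (norm_pos_iff.1 (h0.trans_le hz.1))).continuousWithinAt

lemma setIntegral_annulus {h : ℂ → ℝ} (hh : ∀ z ≠ 0, ContinuousAt h z) {r₀ R : ℝ} (h0 : 0 < r₀)
    (hR : r₀ ≤ R) :
    ∫ z in annulus r₀ R, h z =
      ∫ r in r₀..R, ∫ θ in (-Real.pi)..Real.pi, r * h (polar (r, θ)) := by
  have hpi := Real.pi_pos
  rw [← integral_indicator (measurableSet_annulus r₀ R), ← Complex.integral_comp_polarCoord_symm]
  have e1 : ∀ p : ℝ × ℝ, Complex.polarCoord.symm p = polar p := by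
    intro p
    rw [Complex.polarCoord_symm_apply, polar, Complex.exp_mul_I]
    push_cast
    rfl
  simp only [e1]
  have e2 : ∫ p in polarCoord.target, p.1 • (annulus r₀ R).indicator h (polar p) =
      ∫ p in polarCoord.target, (Set.Ioc r₀ R ×ˢ (Set.univ : Set ℝ)).indicator
        (fun p : ℝ × ℝ => p.1 * h (polar p)) p := by
    refine setIntegral_congr_fun polarCoord.open_target.measurableSet fun p hp => ?_
    have hp1 : 0 < p.1 := hp.1
    have : polar p ∈ annulus r₀ R ↔ p ∈ Set.Ioc r₀ R ×ˢ (Set.univ : Set ℝ) := by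
      simp [annulus, norm_polar, abs_of_pos hp1]
    simp only [Set.indicator, this, smul_eq_mul]
    split_ifs <;> simp
  have hm : MeasurableSet (Set.Ioc r₀ R ×ˢ (Set.univ : Set ℝ)) :=
    measurableSet_Ioc.prod MeasurableSet.univ
  have e3 : polarCoord.target ∩ Set.Ioc r₀ R ×ˢ (Set.univ : Set ℝ)
      = Set.Ioc r₀ R ×ˢ Set.Ioo (-Real.pi) Real.pi := by
    ext p
    simp only [polarCoord_target, Set.mem_inter_iff, Set.mem_prod, Set.mem_Ioi, Set.mem_univ,
      and_true]
    constructor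
    · rintro ⟨⟨_, h2⟩, h3⟩; exact ⟨h3, h2⟩
    · rintro ⟨h3, h2⟩; exact ⟨⟨h0.trans h3.1, h2⟩, h3⟩
  rw [e2, setIntegral_indicator hm, e3, Measure.volume_eq_prod, setIntegral_prod,
    intervalIntegral.integral_of_le hR]
  · refine setIntegral_congr_fun measurableSet_Ioc fun r _ => ?_
    simp only
    rw [intervalIntegral.integral_of_le (by linarith), integral_Ioc_eq_integral_Ioo]
  · have hc : ContinuousOn (fun p : ℝ × ℝ => p.1 * h (polar p))
        (Set.Icc r₀ R ×ˢ Set.Icc (-Real.pi) Real.pi) := fun p hp =>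
      (ContinuousAt.mul (by fun_prop) ((hh _ (polar_ne_zero (h0.trans_le hp.1.1).ne')).comp
        continuous_polar.continuousAt)).continuousWithinAt
    exact (hc.integrableOn_compact (isCompact_Icc.prod isCompact_Icc)).mono_set
      (Set.prod_mono Set.Ioc_subset_Icc_self Set.Ioo_subset_Icc_self)

lemma aecover_annulus :
    AECover (volume : Measure ℂ) atTop fun n : ℕ => annulus (1 / ((n : ℝ) + 1)) ((n : ℝ) + 1) where
  ae_eventually_mem := by
    have h : ∀ᵐ z : ℂ, z ≠ 0 := by
      simp [ae_iff]
    filter_upwards [h] with z hz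
    have h1 : ∀ᶠ n : ℕ in atTop, 1 / ((n : ℝ) + 1) < ‖z‖ :=
      tendsto_one_div_add_atTop_nhds_zero_nat.eventually_lt_const (norm_pos_iff.2 hz)
    have h2 : ∀ᶠ n : ℕ in atTop, ‖z‖ ≤ (n : ℝ) :=
      tendsto_natCast_atTop_atTop.eventually_ge_atTop _
    filter_upwards [h1, h2] with n h1 h2
    exact ⟨h1, by linarith⟩
  measurableSet n := measurableSet_annulus _ _

/-- If `∂f/∂z̄ = h ≥ 0` away from the origin and `z f(z)` has limits at the origin and at infinity,
then `∫ h` is `π` times the difference of these limits. -/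
lemma integral_dzbar_eq {f a : ℂ → ℂ} {h : ℂ → ℝ}
    (hf : ∀ z ≠ 0, HasWirtingerAt f (a z) (h z) z) (hh : ∀ z ≠ 0, ContinuousAt h z)
    (hnonneg : ∀ z, 0 ≤ h z) {c₀ c₁ : ℝ}
    (h₀ : Tendsto (fun z => z * f z) (𝓝[≠] 0) (𝓝 (c₀ : ℂ)))
    (h₁ : Tendsto (fun z => z * f z) (cocompact ℂ) (𝓝 (c₁ : ℂ))) :
    Integrable h ∧ ∫ z, h z = Real.pi * (c₁ - c₀) := by
  have hfc : ∀ z ≠ 0, ContinuousAt f z := fun z hz => (hf z hz).differentiableAt.continuousAt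
  have t₀ : Tendsto (flux f) (𝓝[>] 0) (𝓝 (2 * Real.pi * c₀)) := by
    refine tendsto_flux hfc ?_ ?_
    · filter_upwards [self_mem_nhdsWithin] with r hr
      exact ⟨ne_of_gt hr, le_of_lt hr⟩
    · rwa [comap_norm_nhdsGT_zero]
  have t₁ : Tendsto (flux f) atTop (𝓝 (2 * Real.pi * c₁)) := by
    refine tendsto_flux hfc ?_ ?_
    · filter_upwards [eventually_gt_atTop 0] with r hr
      exact ⟨ne_of_gt hr, le_of_lt hr⟩
    · rwa [comap_norm_atTop, Metric.cobounded_eq_cocompact]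
  have s₀ : Tendsto (fun n : ℕ => 1 / ((n : ℝ) + 1)) atTop (𝓝[>] 0) :=
    tendsto_nhdsWithin_iff.2 ⟨tendsto_one_div_add_atTop_nhds_zero_nat,
      Eventually.of_forall fun n => by simp only [Set.mem_Ioi]; positivity⟩
  have s₁ : Tendsto (fun n : ℕ => (n : ℝ) + 1) atTop atTop :=
    tendsto_atTop_add_const_right _ _ tendsto_natCast_atTop_atTop
  have hint : ∀ n : ℕ, IntegrableOn h (annulus (1 / ((n : ℝ) + 1)) ((n : ℝ) + 1)) := fun n =>
    integrableOn_annulus hh (by positivity) _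
  have hval : ∀ n : ℕ, ((∫ z in annulus (1 / ((n : ℝ) + 1)) ((n : ℝ) + 1), h z : ℝ) : ℂ) =
      (flux f ((n : ℝ) + 1) - flux f (1 / ((n : ℝ) + 1))) / 2 := by
    intro n
    have hpos : 0 < 1 / ((n : ℝ) + 1) := by positivity
    have hle : 1 / ((n : ℝ) + 1) ≤ (n : ℝ) + 1 := by
      have hn : (0 : ℝ) ≤ n := n.cast_nonneg
      rw [div_le_iff₀ (by positivity)]
      nlinarith
    rw [← integral_annulus_polar hf (fun z hz =>
      Complex.continuous_ofReal.continuousAt.comp (hh z hz)) hpos hle, setIntegral_annulus hh hpos hle]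
    simp only [mul_assoc, intervalIntegral.integral_const_mul, ← Complex.ofReal_mul,
      intervalIntegral.integral_ofReal]
    ring
  have hlim : Tendsto (fun n : ℕ => ∫ z in annulus (1 / ((n : ℝ) + 1)) ((n : ℝ) + 1), h z) atTop
      (𝓝 (Real.pi * (c₁ - c₀))) := by
    have h2 := (((t₁.comp s₁).sub (t₀.comp s₀)).div_const 2)
    have h3 := (Complex.continuous_re.tendsto _).comp h2
    have e : ((2 * Real.pi * c₁ - 2 * Real.pi * c₀ : ℂ) / 2).re = Real.pi * (c₁ - c₀) := by
      rw [show (2 * Real.pi * c₁ - 2 * Real.pi * c₀ : ℂ) / 2 = ((Real.pi * (c₁ - c₀) : ℝ) : ℂ) by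
        push_cast; ring]
      exact Complex.ofReal_re _
    rw [e] at h3
    refine h3.congr fun n => ?_
    simp only [Function.comp_apply]
    rw [← hval n, Complex.ofReal_re]
  -- Nonnegativity turns convergence of the integrals over the exhausting annuli into integrability
  -- on the plane.
  have hnn : 0 ≤ᵐ[volume] h := Eventually.of_forall hnonneg
  exact ⟨aecover_annulus.integrable_of_integral_tendsto_of_nonneg_ae _ hint hnn hlim,
    aecover_annulus.integral_eq_of_tendsto_of_nonneg_ae _ hnn hint hlim⟩

/-! ### The integral of `Ũ²` -/

lemma norm_Utilde_sq (C : ℝ) (z : ℂ) (t : ℝ) :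
    ((‖Utilde C z t‖ ^ 2 : ℝ) : ℂ) = Utilde C z t ^ 2 := by
  rw [Utilde_eq_Urat, Complex.norm_real, Real.norm_eq_abs, sq_abs, Complex.ofReal_pow]

lemma ne_singular {z : ℂ} (hz : z ≠ 0) (C t : ℝ) : (z, t) ≠ ((0 : ℂ), C) :=
  fun h => hz (Prod.mk.inj h).1

/-- Both potentials come from ∂_z log τ: its ∂_z is Ṽ and its ∂_z̄ is Ũ², the latter by `num_sq`. -/
lemma hasWirtingerAt_logDeriv_tau (C t : ℝ) (z : ℂ) (hz : z ≠ 0) :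
    HasWirtingerAt (fun z => tauZ z (conj z) ((t - C : ℝ) : ℂ) / tau z (conj z) ((t - C : ℝ) : ℂ))
      (Vtilde C z t) ((‖Utilde C z t‖ ^ 2 : ℝ) : ℂ) z := by
  have h0 := tau_ne_zero (ne_singular hz C t)
  refine ((hasWirtingerAt_tauZ z _).div (hasWirtingerAt_tau z _) h0).congr_values ?_ ?_
  · rw [Vtilde_eq, sq (tauZ _ _ _)]
  · rw [norm_Utilde_sq, Utilde_eq, div_pow, num_sq]
    ring

lemma continuousAt_norm_Utilde_sq (C t : ℝ) (z : ℂ) (hz : z ≠ 0) :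
    ContinuousAt (fun z => ‖Utilde C z t‖ ^ 2) z := by
  have h := (hasWirtingerAt_U (tau_ne_zero (ne_singular hz C t))).differentiableAt.continuousAt
  simp only [← Utilde_eq] at h
  exact h.norm.pow 2

/-! ### Limits of z ∂_z log τ at infinity and at the origin -/

lemma tendsto_mul_logDeriv_tau_cocompact (C t : ℝ) :
    Tendsto (fun z => z * (tauZ z (conj z) ((t - C : ℝ) : ℂ) / tau z (conj z) ((t - C : ℝ) : ℂ)))
      (cocompact ℂ) (𝓝 3) := by
  have h1 := (growthLE_mul_tauZ_sub ((t - C : ℝ) : ℂ)).div_isBigO (n := 2)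
    (norm_pow_six_isBigO_tau C t)
  have h2 : Tendsto (fun z : ℂ => (‖z‖ ^ 2)⁻¹) (cocompact ℂ) (𝓝 0) :=
    tendsto_inv_atTop_zero.comp
      ((tendsto_pow_atTop two_ne_zero).comp tendsto_norm_cocompact_atTop)
  have h3 := (h1.trans_tendsto h2).add_const 3
  rw [zero_add] at h3
  refine h3.congr' ?_
  filter_upwards [(tendsto_norm_cocompact_atTop (E := ℂ)).eventually_gt_atTop 0] with z hz
  have h0 := tau_ne_zero (ne_singular (norm_pos_iff.1 hz) C t)
  field_simp
  ring

lemma tendsto_mul_logDeriv_tau_zero {C t : ℝ} (h : t ≠ C) :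
    Tendsto (fun z => z * (tauZ z (conj z) ((t - C : ℝ) : ℂ) / tau z (conj z) ((t - C : ℝ) : ℂ)))
      (𝓝[≠] 0) (𝓝 0) := by
  have h0 := tau_ne_zero (C := C) (z := 0) (t := t) fun h' => h (Prod.mk.inj h').2
  have hc := ((HasWirtingerAt.id 0).mul
    ((hasWirtingerAt_tauZ 0 ((t - C : ℝ) : ℂ)).div (hasWirtingerAt_tau 0 _) h0)).differentiableAt.continuousAt
  simpa only [ContinuousAt, zero_mul] using hc.tendsto.mono_left nhdsWithin_le_nhds

lemma tendsto_mul_logDeriv_tau_singular :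
    Tendsto (fun z => z * (tauZ z (conj z) 0 / tau z (conj z) 0)) (𝓝[≠] 0) (𝓝 1) := by
  -- For r = |z| < 1 the numerator of z τ_z/τ - 1 is at most 6r⁴ and τ ≥ (2r/3)², so the quotient is
  -- at most 13.5 r²; 15 leaves room.
  have hlim : Tendsto (fun z : ℂ => 15 * ‖z‖ ^ 2) (𝓝[≠] 0) (𝓝 0) := by
    have : Continuous fun z : ℂ => 15 * ‖z‖ ^ 2 := by fun_prop
    simpa using (this.tendsto 0).mono_left nhdsWithin_le_nhds
  rw [tendsto_iff_norm_sub_tendsto_zero]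
  refine squeeze_zero' (Eventually.of_forall fun z => norm_nonneg _) ?_ hlim
  have hball : ∀ᶠ z : ℂ in 𝓝[≠] 0, ‖z‖ < 1 :=
    nhdsWithin_le_nhds (continuousAt_id.norm.eventually_lt_const (by simp))
  filter_upwards [hball, self_mem_nhdsWithin] with z hz1 hz
  have hr : 0 < ‖z‖ := norm_pos_iff.2 hz
  have h0 : tau z (conj z) 0 ≠ 0 := by
    simpa using tau_ne_zero (ne_singular hz 0 0)
  -- In z τ_z - τ the quadratic term z z̄ cancels, since z + `cubic z̄ z 0` = z̄³/3; each remaining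
  -- term is of order r⁴.
  have e : z * (tauZ z (conj z) 0 / tau z (conj z) 0) - 1 =
      (2 * quad z (conj z) * z ^ 2 + z ^ 3 * cubic (conj z) z 0
        - cubic z (conj z) 0 * (conj z ^ 3 / 3) - quad z (conj z) ^ 2) / tau z (conj z) 0 := by
    field_simp
    simp only [tau, tauZ, cubic]
    ring
  have hr3 : ‖z‖ ^ 3 ≤ ‖z‖ := by
    calc ‖z‖ ^ 3 ≤ ‖z‖ ^ 1 := pow_le_pow_of_le_one hr.le hz1.le (by norm_num)
      _ = ‖z‖ := pow_one _
  have hq : ‖quad z (conj z)‖ ≤ ‖z‖ ^ 2 := by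
    have := norm_add_le (z ^ 2) (conj z ^ 2)
    simp only [norm_pow, RCLike.norm_conj] at this
    rw [quad, norm_div, Complex.norm_ofNat]
    linarith
  have hc : ‖cubic z (conj z) 0‖ ≤ 2 * ‖z‖ := by
    have := norm_sub_le (z ^ 3 / 3) (conj z)
    simp only [norm_pow, norm_div, RCLike.norm_conj, Complex.norm_ofNat] at this
    rw [cubic, sub_zero]
    linarith
  have hc' : ‖cubic (conj z) z 0‖ ≤ 2 * ‖z‖ := by
    have := norm_sub_le (conj z ^ 3 / 3) z
    simp only [norm_pow, norm_div, RCLike.norm_conj, Complex.norm_ofNat] at this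
    rw [cubic, sub_zero]
    linarith
  have hden : (2 / 3 * ‖z‖) ^ 2 ≤ ‖tau z (conj z) 0‖ := by
    have h1 := norm_tau 0 z 0
    simp only [sub_self, Complex.ofReal_zero] at h1
    rw [h1, den]
    have h2 : 2 / 3 * ‖z‖ ≤ ‖del 0 z 0‖ := by
      rw [del_eq, norm_mul, Complex.norm_I, one_mul, cubic, sub_self, Complex.ofReal_zero, sub_zero,
        norm_sub_rev]
      have := norm_sub_norm_le z (conj z ^ 3 / 3)
      simp only [norm_pow, norm_div, RCLike.norm_conj, Complex.norm_ofNat] at this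
      linarith
    have h3 : (2 / 3 * ‖z‖) ^ 2 ≤ ‖del 0 z 0‖ ^ 2 := by gcongr
    have := sq_nonneg ‖gam z‖
    linarith
  have hnum : ‖2 * quad z (conj z) * z ^ 2 + z ^ 3 * cubic (conj z) z 0
        - cubic z (conj z) 0 * (conj z ^ 3 / 3) - quad z (conj z) ^ 2‖ ≤ 6 * ‖z‖ ^ 4 := by
    have n1 : ‖2 * quad z (conj z) * z ^ 2‖ ≤ 2 * ‖z‖ ^ 2 * ‖z‖ ^ 2 := by
      rw [norm_mul, norm_mul, Complex.norm_ofNat, norm_pow]; gcongr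
    have n2 : ‖z ^ 3 * cubic (conj z) z 0‖ ≤ ‖z‖ ^ 3 * (2 * ‖z‖) := by
      rw [norm_mul, norm_pow]; gcongr
    have n3 : ‖cubic z (conj z) 0 * (conj z ^ 3 / 3)‖ ≤ 2 * ‖z‖ * (‖z‖ ^ 3 / 3) := by
      rw [norm_mul, norm_div, norm_pow, RCLike.norm_conj, Complex.norm_ofNat]; gcongr
    have n4 : ‖quad z (conj z) ^ 2‖ ≤ (‖z‖ ^ 2) ^ 2 := by
      rw [norm_pow]; gcongr
    have m1 := norm_sub_le (2 * quad z (conj z) * z ^ 2 + z ^ 3 * cubic (conj z) z 0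
        - cubic z (conj z) 0 * (conj z ^ 3 / 3)) (quad z (conj z) ^ 2)
    have m2 := norm_sub_le (2 * quad z (conj z) * z ^ 2 + z ^ 3 * cubic (conj z) z 0)
      (cubic z (conj z) 0 * (conj z ^ 3 / 3))
    have m3 := norm_add_le (2 * quad z (conj z) * z ^ 2) (z ^ 3 * cubic (conj z) z 0)
    have p4 : 0 ≤ ‖z‖ ^ 4 := by positivity
    calc _ ≤ 2 * ‖z‖ ^ 2 * ‖z‖ ^ 2 + ‖z‖ ^ 3 * (2 * ‖z‖) + 2 * ‖z‖ * (‖z‖ ^ 3 / 3)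
          + (‖z‖ ^ 2) ^ 2 := by linarith
      _ = (5 + 2 / 3) * ‖z‖ ^ 4 := by ring
      _ ≤ 6 * ‖z‖ ^ 4 := by linarith
  rw [e, norm_div, div_le_iff₀ (norm_pos_iff.2 h0)]
  have p4 : 0 ≤ ‖z‖ ^ 4 := by positivity
  calc _ ≤ 6 * ‖z‖ ^ 4 := hnum
    _ ≤ 15 * ‖z‖ ^ 2 * (2 / 3 * ‖z‖) ^ 2 := by
      have : 15 * ‖z‖ ^ 2 * (2 / 3 * ‖z‖) ^ 2 = (20 / 3) * ‖z‖ ^ 4 := by ring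
      linarith
    _ ≤ 15 * ‖z‖ ^ 2 * ‖tau z (conj z) 0‖ := by gcongr

lemma integral_norm_Utilde_sq (C t : ℝ) :
    Integrable (fun z : ℂ => ‖Utilde C z t‖ ^ 2) ∧
      ∫ z : ℂ, ‖Utilde C z t‖ ^ 2 = if t = C then 2 * Real.pi else 3 * Real.pi := by
  have main := fun (c : ℝ) hc => integral_dzbar_eq (c₀ := c) (c₁ := 3)
    (hasWirtingerAt_logDeriv_tau C t) (continuousAt_norm_Utilde_sq C t) (fun z => by positivity) hc
    (by simpa only [Complex.ofReal_ofNat] using tendsto_mul_logDeriv_tau_cocompact C t)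
  split_ifs with h
  · subst h
    obtain ⟨h1, h2⟩ := main 1 (by
      simpa only [sub_self, Complex.ofReal_zero, Complex.ofReal_one] using
        tendsto_mul_logDeriv_tau_singular)
    exact ⟨h1, by rw [h2]; ring⟩
  · obtain ⟨h1, h2⟩ := main 0 (by
      simpa only [Complex.ofReal_zero] using tendsto_mul_logDeriv_tau_zero h)
    exact ⟨h1, by rw [h2]; ring⟩

end MNV

end

theorem theorem2 (C : ℝ) :
    -- the construction: the Weierstrass representation of the translated Enneper surfaces, ...
    ((∀ t, IsWeierstrassSurface (fun z => z) (fun _ => 1) (enneper C t)) ∧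
      enneper C 0 0 = ![0, -C, 0] ∧
      (∀ z t, enneperS C z t = su2 (enneper C t z)) ∧
      -- ... the Moutard transformation of the zero potential ...
      IsMoutardTransformOfZero {((0 : ℂ), C)}ᶜ
        (spinorMatrix (fun z _ => z) (fun _ _ => 1)) (enneperS C) (Utilde C) (Vtilde C) ∧
      -- ... and the rational formula
      (∀ z t, (z, t) ≠ ((0 : ℂ), C) →
        Qpoly C z.re z.im t ≠ 0 ∧ Utilde C z t = (Urat C z.re z.im t : ℂ))) ∧
    -- (1) the modified Novikov–Veselov equation
    IsMNVSolutionOn {((0 : ℂ), C)}ᶜ (Utilde C) (Vtilde C) ∧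
    -- (2) quadratic decay
    (∀ t, (fun z : ℂ => Utilde C z t) =O[cocompact ℂ] (fun z : ℂ => (‖z‖ ^ 2)⁻¹) ∧
      (fun z : ℂ => Vtilde C z t) =O[cocompact ℂ] (fun z : ℂ => (‖z‖ ^ 2)⁻¹)) ∧
    -- (3) real analyticity for `t ≠ C`
    (AnalyticOnNhd ℝ (fun p : ℂ × ℝ => Utilde C p.1 p.2) {p | p.2 ≠ C} ∧
      AnalyticOnNhd ℝ (fun p : ℂ × ℝ => Vtilde C p.1 p.2) {p | p.2 ≠ C}) ∧
    -- (4) the only singular point is `x = y = 0`, `t = C`; directional limits of `Ũ` there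
    ((∀ z t, den C z t = 0 ↔ (z, t) = ((0 : ℂ), C)) ∧
      AnalyticOnNhd ℝ (fun p : ℂ × ℝ => Utilde C p.1 p.2) {((0 : ℂ), C)}ᶜ ∧
      AnalyticOnNhd ℝ (fun p : ℂ × ℝ => Vtilde C p.1 p.2) {((0 : ℂ), C)}ᶜ ∧
      (¬ ∃ L : ℂ, Tendsto (fun p : ℂ × ℝ => Utilde C p.1 p.2) (𝓝[≠] ((0 : ℂ), C)) (𝓝 L)) ∧
      (¬ ∃ L : ℂ, Tendsto (fun p : ℂ × ℝ => Vtilde C p.1 p.2) (𝓝[≠] ((0 : ℂ), C)) (𝓝 L)) ∧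
      (∀ φ : ℝ, Tendsto (fun r : ℝ => Utilde C (r * Complex.exp (φ * Complex.I)) C)
        (𝓝[>] 0) (𝓝 (-(Real.cos (2 * φ) : ℂ))))) ∧
    -- (5) the jump of the conserved quantity
    (∀ t, Integrable (fun z : ℂ => ‖Utilde C z t‖ ^ 2) ∧
      ∫ z : ℂ, ‖Utilde C z t‖ ^ 2 = if t = C then 2 * Real.pi else 3 * Real.pi) := by
  have hsub : {p : ℂ × ℝ | p.2 ≠ C} ⊆ {((0 : ℂ), C)}ᶜ := fun p hp h => hp (by rw [h])
  exact ⟨⟨isWeierstrassSurface_enneper C, by ext i; fin_cases i <;> simp [enneper],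
      enneperS_eq_su2 C, isMoutardTransformOfZero_enneper C,
      fun z t h => ⟨Qpoly_ne_zero h, Utilde_eq_Urat C z t⟩⟩,
    isMNVSolutionOn C, fun t => ⟨Utilde_isBigO C t, Vtilde_isBigO C t⟩,
    ⟨(analyticOnNhd_Utilde C).mono hsub, (analyticOnNhd_Vtilde C).mono hsub⟩,
    ⟨den_eq_zero_iff C, analyticOnNhd_Utilde C, analyticOnNhd_Vtilde C, not_tendsto_Utilde C,
      not_tendsto_Vtilde C, tendsto_Utilde_radial C⟩,
    integral_norm_Utilde_sq C⟩
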